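/- \textbf{Proposition (hardness of powering matrices of bounded tree-width).} For an integer square matrix $A$, its underlying undirected graph has the indices as vertices, distinct $u,v$ being adjacent iff $A_{uv}\neq 0$ or $A_{vu}\neq 0$; the tree-width of $A$ is the tree-width of this graph. For $k\ge 1$ let $\mathrm{POW}_k$ be the following promise problem: given an integer matrix $A$ of tree-width at most $k$ (entries in signed binary), numbers $m$ and $b$ in unary, and indices $i,j$ of $A$, decide whether the bit of weight $2^b$ of $|(A^m)_{ij}|$ is $1$. Let $\mathsf{ORD}$ be the problem of deciding, for a directed path $P$ (given by its edge relation on its vertex set $V(P)$) and two vertices $s,t$ of $P$, whether $t$ is reachable from $s$ in $P$. Inputs are finite structures with universe $\{0,\dots,N-1\}$. A binary word $x$ is the structure with universe $\{0,\dots,|x|+1\}$ and one unary predicate marking the positions $p\in\{1,\dots,|x|\}$ of the ones of $x$. An instance $(A,1^m,i,j,1^b)$ is encoded with the dimension, $m$ and $b$ given as initial segments of the universe, $i,j$ as elements, and the entries of $A$ through a relation for their signs and one for the bits of their absolute values. A problem $X$ is (first-order) \emph{disjunctive truth-table reducible} to a promise problem $Y$ if there are constants $d,r$ and a first-order query $I$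 of dimension $r$ with $d$ parameters, using the vocabulary of the input and the numerical predicates $<,+,\times,\mathrm{BIT}$ (that is, computable in $\mathsf{DLOGTIME}$-uniform $\mathsf{AC}^0$), such that for every instance $S$ of $X$ with universe $U$ all the queries $I(S,z)$, $z\in U^d$, are legal instances of $Y$, and $S\in X$ if and only if $I(S,z)\in Y$ for at least one $z\in U^d$. Then: \begin{enumerate} \item For every $k\ge 1$, $\mathrm{POW}_k$ is $\mathsf L$-hard under disjunctive truth-table reductions: every language over $\{0,1\}$ that is decided by a deterministic Turing machine in space $O(\log n)$ is disjunctive truth-table reducible to $\mathrm{POW}_k$. \item For every $k\ge 1$, $\mathsf{ORD}$ is disjunctive truth-table reducible to $\mathrm{POW}_k$. \item For every directed path $P$ on $n$ vertices with adjacency matrix $A_P$, and all vertices $s,t$ of $P$: $t$ is reachable from $s$ in $P$ if and only if $\bigl((I+A_P)^n\bigr)_{s,t}\neq 0$. \end{enumerate} -/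

import Mathlib

noncomputable section

namespace BTPow



/-! ### Deterministic logarithmic space -/

/-- Symbols on the read-only input tape: two end markers and the input bits. -/
inductive InSym where
  | leftEnd : InSym
  | rightEnd : InSym
  | bit : Bool → InSym

/-- Head movements. -/
inductive Move where
  | left : Move
  | stay : Move
  | right : Move

/-- A deterministic Turing machine with a two-way read-only input tape and one read-write work
tape (infinite to the right).  The machine halts when the transition function is undefined. -/
structure Machine where
  Q : Type
  Γ : Type
  finQ : Finite Q
  finΓ : Finite Γ
  blank : Γ
  start : Q
  accepting : Set Q
  δ : Q → InSym → Γ → Option (Q × Γ × Move × Move)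

namespace Machine

/-- Configurations: state, input head position, work tape contents, work head position. -/
structure Cfg (M : Machine) where
  state : M.Q
  inPos : ℕ
  tape : ℕ → M.Γ
  head : ℕ

/-- The content of cell `p` of the input tape for the input `x`: cell `0` holds the left marker,
cells `1, …, |x|` hold the input, cell `|x| + 1` holds the right marker. -/
def readInput (x : List Bool) : ℕ → InSym
  | 0 => InSym.leftEnd
  | p + 1 => match x[p]? with
    | some b => InSym.bit b
    | none => InSym.rightEnd

def movePos : Move → ℕ → ℕ
  | Move.left, p => p - 1
  | Move.stay, p => p
  | Move.right, p => p + 1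

/-- One step of computation on input `x`; `none` means that the configuration is halting.
The input head never leaves the cells `0, …, |x| + 1`. -/
def step (M : Machine) (x : List Bool) (c : M.Cfg) : Option M.Cfg :=
  match M.δ c.state (readInput x c.inPos) (c.tape c.head) with
  | none => none
  | some (q, a, mi, mw) => some
      { state := q
        inPos := min (movePos mi c.inPos) (x.length + 1)
        tape := Function.update c.tape c.head a
        head := movePos mw c.head }

def init (M : Machine) : M.Cfg where
  state := M.start
  inPos := 0
  tape := fun _ => M.blank
  head := 0

/-- `c` occurs in the computation of `M` on input `x`. -/
def Reaches (M : Machine) (x : List Bool) (c : M.Cfg) : Prop :=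
  Relation.ReflTransGen (fun c₁ c₂ => M.step x c₁ = some c₂) M.init c

/-- `M` halts on every input, and accepts exactly the words of `A`. -/
def Decides (M : Machine) (A : Language Bool) : Prop :=
  ∀ x : List Bool, ∃ c, M.Reaches x c ∧ M.step x c = none ∧ (c.state ∈ M.accepting ↔ x ∈ A)

/-- `M` visits only `O(log |x|)` work tape cells on every input `x`. -/
def UsesLogSpace (M : Machine) : Prop :=
  ∃ C : ℕ, ∀ (x : List Bool) (c : M.Cfg), M.Reaches x c →
    c.head < C * (Nat.log 2 x.length + 1)

end Machine

/-- The complexity class `L`. -/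
def LogSpace : Set (Language Bool) :=
  {A | ∃ M : Machine, M.UsesLogSpace ∧ M.Decides A}

/-! ### Finite ordered structures and first-order reductions -/

/-- A finite structure over the vocabulary `σ` with universe `{0, …, card - 1}`. -/
structure FinStr (σ : FirstOrder.Language.{0, 0}) where
  card : ℕ
  str : σ.Structure (Fin card)

/-- The truth value of the atomic statement `R(v)` in `S`. -/
def FinStr.Rel {σ : FirstOrder.Language.{0, 0}} (S : FinStr σ) {a : ℕ} (R : σ.Relations a)
    (v : Fin a → Fin S.card) : Prop :=
  letI := S.str
  FirstOrder.Language.Structure.RelMap R v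

/-- A promise problem on finite ordered structures: a set of legal instances, together with the
set of those that are to be accepted. -/
structure Problem (σ : FirstOrder.Language.{0, 0}) where
  legal : Set (FinStr σ)
  yes : Set (FinStr σ)

/-- The numerical predicates: order, the graphs of addition and multiplication, and `BIT`. -/
inductive NumRel : ℕ → Type where
  | lt : NumRel 2
  | add : NumRel 3
  | mul : NumRel 3
  | bit : NumRel 2

def numLang : FirstOrder.Language.{0, 0} := ⟨fun _ => Empty, NumRel⟩

/-- The numerical predicates have their standard meaning on `{0, …, N - 1}`;
`BIT(a, b)` says that the bit of weight `2 ^ b` in the binary notation of `a` is one. -/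
instance numStructure (N : ℕ) : numLang.Structure (Fin N) where
  funMap := fun f => f.elim
  RelMap := fun R => match R with
    | NumRel.lt => fun v => (v 0 : ℕ) < (v 1 : ℕ)
    | NumRel.add => fun v => (v 0 : ℕ) + (v 1 : ℕ) = (v 2 : ℕ)
    | NumRel.mul => fun v => (v 0 : ℕ) * (v 1 : ℕ) = (v 2 : ℕ)
    | NumRel.bit => fun v => (v 0 : ℕ).testBit (v 1 : ℕ) = true

/-- An `r`-dimensional first-order query from `σ`-structures to `τ`-structures, with `d`
parameters: each relation symbol of `τ` of arity `a` is defined by a first-order formula over `σ`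
and the numerical predicates, whose free variables are the `d` parameters and `a` blocks of `r`
variables each. -/
structure FOQuery (σ τ : FirstOrder.Language.{0, 0}) (d r : ℕ) where
  formula : ∀ {a : ℕ}, τ.Relations a → (numLang.sum σ).Formula (Fin d ⊕ (Fin a × Fin r))

/-- The structure defined by the query in `S` for the parameters `z`.  Its universe consists of
the `r`-tuples over the universe of `S`, a tuple `u` being identified with the number
`∑ i, u i * S.card ^ i` in `{0, …, S.card ^ r - 1}`. -/
def FOQuery.output {σ τ : FirstOrder.Language.{0, 0}} [τ.IsRelational] {d r : ℕ} (I : FOQuery σ τ d r)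
    (S : FinStr σ) (z : Fin d → Fin S.card) : FinStr τ where
  card := S.card ^ r
  str :=
    { funMap := fun f => isEmptyElim f
      RelMap := fun R v =>
        letI := S.str
        (I.formula R).Realize
          (Sum.elim z fun p => (finFunctionFinEquiv.symm (v p.1) : Fin r → Fin S.card) p.2) }

/-- First-order disjunctive truth-table reducibility: from the instance `S` of `P` one computes,
by a first-order query, the family of queries `I.output S z` to `R`, one for each `d`-tuple `z`
over the universe of `S` (hence polynomially many).  All of them are legal instances of `R`,
and `S` is to be accepted iff at least one of them is. -/
def FODisjunctiveReducible {σ τ : FirstOrder.Language.{0, 0}} [τ.IsRelational]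
    (P : Problem σ) (R : Problem τ) : Prop :=
  ∃ (d r : ℕ) (I : FOQuery σ τ d r), ∀ S ∈ P.legal,
    (∀ z, I.output S z ∈ R.legal) ∧ (S ∈ P.yes ↔ ∃ z, I.output S z ∈ R.yes)

/-! ### Words as structures, and hardness for `L` -/

inductive WordRel : ℕ → Type where
  | one : WordRel 1

def wordLang : FirstOrder.Language.{0, 0} := ⟨fun _ => Empty, WordRel⟩

/-- The word `x` as a structure with universe `{0, …, |x| + 1}`: the positions `1, …, |x|` carry
the letters, `0` and `|x| + 1` are the end positions, and `one p` says that letter `p` is a one. -/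
def wordStr (x : List Bool) : FinStr wordLang where
  card := x.length + 2
  str :=
    { funMap := fun f => f.elim
      RelMap := fun R => match R with
        | WordRel.one => fun v => 1 ≤ (v 0 : ℕ) ∧ x[(v 0 : ℕ) - 1]? = some true }

/-- The membership problem of a language of binary words. -/
def wordProblem (A : Language Bool) : Problem wordLang where
  legal := Set.range wordStr
  yes := {S | ∃ x ∈ A, wordStr x = S}

/-- `R` is `L`-hard under (first-order) disjunctive truth-table reductions. -/
def LHard {τ : FirstOrder.Language.{0, 0}} [τ.IsRelational] (R : Problem τ) : Prop :=
  ∀ A ∈ LogSpace, FODisjunctiveReducible (wordProblem A) R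

/-! ### Tree-width -/

/-- A tree decomposition of a graph. -/
structure TreeDecomposition {V : Type*} (G : SimpleGraph V) where
  size : ℕ
  tree : SimpleGraph (Fin size)
  isTree : tree.IsTree
  bag : Fin size → Finset V
  cover : ∀ v, ∃ i, v ∈ bag i
  convex : ∀ (v : V) (i j : Fin size) (p : tree.Walk i j), p.IsPath → v ∈ bag i → v ∈ bag j →
    ∀ l ∈ p.support, v ∈ bag l
  edge : ∀ u v, G.Adj u v → ∃ i, u ∈ bag i ∧ v ∈ bag i

def TreeDecomposition.width {V : Type*} {G : SimpleGraph V} (D : TreeDecomposition G) : ℕ :=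
  Finset.univ.sup fun i => (D.bag i).card - 1

/-- The tree-width of a finite graph. -/
def treewidth {V : Type*} (G : SimpleGraph V) : ℕ :=
  sInf (Set.range (TreeDecomposition.width (G := G)))

/-- The undirected graph underlying a square matrix: distinct `u`, `v` are adjacent iff the
entry `(u, v)` or the entry `(v, u)` is nonzero. -/
def supportGraph {V : Type*} (A : Matrix V V ℤ) : SimpleGraph V :=
  SimpleGraph.fromRel fun u v => A u v ≠ 0

/-! ### Powering matrices of bounded tree-width -/

inductive PowRel : ℕ → Type where
  | dim : PowRel 1
  | entryBit : PowRel 3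
  | entryNeg : PowRel 2
  | exponent : PowRel 1
  | row : PowRel 1
  | col : PowRel 1
  | position : PowRel 1

/-- The vocabulary of instances `(A, 1^m, i, j, 1^b)` of matrix powering. -/
def powLang : FirstOrder.Language.{0, 0} := ⟨fun _ => Empty, PowRel⟩

instance : powLang.IsRelational := fun _ => inferInstanceAs (IsEmpty Empty)

namespace PowInstance

/-- The index set `{0, …, n - 1}` of the rows and columns of the matrix. -/
def Index (S : FinStr powLang) : Type := {p : Fin S.card // S.Rel PowRel.dim ![p]}

instance (S : FinStr powLang) : Fintype (Index S) := by
  classical exact inferInstanceAs (Fintype {p : Fin S.card // S.Rel PowRel.dim ![p]})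

instance (S : FinStr powLang) : DecidableEq (Index S) := Classical.decEq _

open Classical in
/-- The matrix: its entries are integers, given by their sign and by the binary notation of
their absolute value. -/
def matrix (S : FinStr powLang) : Matrix (Index S) (Index S) ℤ := fun p q =>
  (if S.Rel PowRel.entryNeg ![p.1, q.1] then -1 else 1) *
    ∑ b : Fin S.card, if S.Rel PowRel.entryBit ![p.1, q.1, b] then 2 ^ (b : ℕ) else 0

/-- The exponent `m`, in unary. -/
def exponent (S : FinStr powLang) : ℕ := {p | S.Rel PowRel.exponent ![p]}.ncard

/-- The requested bit position `b`, in unary. -/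
def position (S : FinStr powLang) : ℕ := {p | S.Rel PowRel.position ![p]}.ncard

/-- The structure is the encoding of some `(A, 1^m, i, j, 1^b)`: numbers in unary are given by
initial segments of the universe, and `i`, `j` are indices of `A`. -/
def WellFormed (S : FinStr powLang) : Prop :=
  IsLowerSet {p | S.Rel PowRel.dim ![p]} ∧
  IsLowerSet {p | S.Rel PowRel.exponent ![p]} ∧
  IsLowerSet {p | S.Rel PowRel.position ![p]} ∧
  (∃! p, S.Rel PowRel.row ![p]) ∧ (∃! p, S.Rel PowRel.col ![p]) ∧
  (∀ p, S.Rel PowRel.row ![p] → S.Rel PowRel.dim ![p]) ∧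
  (∀ p, S.Rel PowRel.col ![p] → S.Rel PowRel.dim ![p])

end PowInstance

open PowInstance in
/-- Powering integer matrices of tree-width at most `k`: given `(A, 1^m, i, j, 1^b)`, where the
graph underlying `A` has tree-width at most `k`, is the bit of weight `2 ^ b` of (the absolute
value of) the entry `(i, j)` of `A ^ m` equal to one? -/
def matrixPowering (k : ℕ) : Problem powLang where
  legal := {S | WellFormed S ∧ treewidth (supportGraph (matrix S)) ≤ k}
  yes := {S | (WellFormed S ∧ treewidth (supportGraph (matrix S)) ≤ k) ∧
    ∃ i j : Index S, S.Rel PowRel.row ![i.1] ∧ S.Rel PowRel.col ![j.1] ∧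
      ((matrix S ^ exponent S) i j).natAbs.testBit (position S) = true}

/-! ### The problem `ORD` -/

/-- `E` is the edge relation of a directed path through all the vertices in `V`. -/
def IsDirectedPath {V : Type*} (E : V → V → Prop) : Prop :=
  ∃ (n : ℕ) (e : Fin n ≃ V), ∀ i j, E (e i) (e j) ↔ (i : ℕ) + 1 = (j : ℕ)

open Classical in
/-- The adjacency matrix of a directed graph. -/
def adjacency {V : Type*} (E : V → V → Prop) : Matrix V V ℤ := fun u v => if E u v then 1 else 0

inductive OrdRel : ℕ → Type where
  | edge : OrdRel 2
  | source : OrdRel 1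
  | target : OrdRel 1

def ordLang : FirstOrder.Language.{0, 0} := ⟨fun _ => Empty, OrdRel⟩

/-- `ORD`: given a directed path and two of its vertices `s`, `t`, is `t` reachable from `s`? -/
def ORD : Problem ordLang where
  legal := {S | IsDirectedPath (fun u v => S.Rel OrdRel.edge ![u, v]) ∧
    (∃! s, S.Rel OrdRel.source ![s]) ∧ (∃! t, S.Rel OrdRel.target ![t])}
  yes := {S | (IsDirectedPath (fun u v => S.Rel OrdRel.edge ![u, v]) ∧
    (∃! s, S.Rel OrdRel.source ![s]) ∧ (∃! t, S.Rel OrdRel.target ![t])) ∧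
    ∃ s t, S.Rel OrdRel.source ![s] ∧ S.Rel OrdRel.target ![t] ∧
      Relation.ReflTransGen (fun u v => S.Rel OrdRel.edge ![u, v]) s t}

end BTPow

end

open BTPow

noncomputable section

namespace BTPow

/-! Both hardness claims rest on one observation. Let a relation `R` have out-degree at most one,
and let every edge that is not a loop raise a rank. Without its loops it is a forest oriented
towards the roots, so its 0/1 matrix has tree-width at most one (`treewidth_supportGraph_le_one`).
The walk from `i` is forced, so the `m`-th power has entry 1 at `(i, j)` if the walk of length `m`
ends in `j`, and 0 otherwise (`pow_apply_of_functional`). If `m` exceeds every rank, that walk must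
have entered a loop; hence the entry is 1 iff `j` is reachable from `i` and carries a loop
(`stepsTo_iff`). The bit of weight 1 thus decides reachability of a looped vertex, and
`reducible_of_definable_forest` turns any first-order definable forest of this kind into a
reduction.

For logarithmic space the vertices are pairs of a coded configuration and a clock. A work tape of
logarithmic length is packed into the bits of a constant number of universe elements, which `BIT`
can read; the clock supplies the rank, and accepting halting configurations carry loops. The final
vertex is unknown, so the disjunction ranges over all candidates. For `ORD` one redirects the edge
leaving the target into a loop, and a single query suffices.

The last claim uses the same walks with a loop at every vertex: powers of `1 + A` are sums of
nonnegative terms, so nothing cancels, and `n` lazy steps are enough to follow a path on `n`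
vertices.

Definability is treated semantically, through closure properties of `FODefinable`, so formulas are
never written out. -/

/-! ### First-order definable predicates on families of structures -/

/-- A predicate on assignments to the variables `α` in the structures `F x` is definable if it is
given, uniformly in `x`, by a first-order formula with numerical predicates. -/
def FODefinable {σ : FirstOrder.Language.{0, 0}} {X : Type*} (F : X → FinStr σ) {α : Type}
    (R : ∀ x, (α → Fin (F x).card) → Prop) : Prop :=
  ∃ φ : (numLang.sum σ).Formula α, ∀ (x : X) (v : α → Fin (F x).card),
    (letI := (F x).str; φ.Realize v) ↔ R x v

namespace FODefinable

variable {σ : FirstOrder.Language.{0, 0}} {X : Type*} {F : X → FinStr σ} {α β : Type}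
  {R R' : ∀ x, (α → Fin (F x).card) → Prop}

theorem congr (h : FODefinable F R) (hR : ∀ x v, R x v ↔ R' x v) : FODefinable F R' :=
  let ⟨φ, hφ⟩ := h
  ⟨φ, fun x v => (hφ x v).trans (hR x v)⟩

/-- Since `p` depends on neither structure nor assignment, its truth value is fixed outside the
formula. Conditions on the transition table enter the queries in this way. -/
theorem const (p : Prop) : FODefinable F (fun x (_ : α → Fin (F x).card) => p) := by
  by_cases hp : p
  · exact ⟨⊤, fun x v => by simp [hp, FirstOrder.Language.Formula.Realize]⟩
  · exact ⟨⊥, fun x v => by simp [hp, FirstOrder.Language.Formula.Realize]⟩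

theorem not (h : FODefinable F R) : FODefinable F (fun x v => ¬ R x v) :=
  let ⟨φ, hφ⟩ := h
  ⟨φ.not, fun x v => by
    let := (F x).str
    rw [FirstOrder.Language.Formula.realize_not, hφ]⟩

theorem and (h : FODefinable F R) (h' : FODefinable F R') :
    FODefinable F (fun x v => R x v ∧ R' x v) :=
  let ⟨φ, hφ⟩ := h
  let ⟨ψ, hψ⟩ := h'
  ⟨φ ⊓ ψ, fun x v => by
    let := (F x).str
    rw [FirstOrder.Language.Formula.realize_inf, hφ, hψ]⟩

theorem or (h : FODefinable F R) (h' : FODefinable F R') :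
    FODefinable F (fun x v => R x v ∨ R' x v) :=
  let ⟨φ, hφ⟩ := h
  let ⟨ψ, hψ⟩ := h'
  ⟨φ ⊔ ψ, fun x v => by
    let := (F x).str
    rw [FirstOrder.Language.Formula.realize_sup, hφ, hψ]⟩

theorem iff (h : FODefinable F R) (h' : FODefinable F R') :
    FODefinable F (fun x v => R x v ↔ R' x v) :=
  let ⟨φ, hφ⟩ := h
  let ⟨ψ, hψ⟩ := h'
  ⟨φ.iff ψ, fun x v => by
    let := (F x).str
    rw [FirstOrder.Language.Formula.realize_iff, hφ, hψ]⟩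

/-- Existential quantification over elements of the universe. -/
theorem ex {R : ∀ x, (α → Fin (F x).card) → Fin (F x).card → Prop}
    (h : FODefinable F (α := α ⊕ Unit) fun x w => R x (w ∘ Sum.inl) (w (Sum.inr ()))) :
    FODefinable F (fun x v => ∃ a, R x v a) := by
  obtain ⟨φ, hφ⟩ := h
  refine ⟨φ.iExs Unit, fun x v => ?_⟩
  let := (F x).str
  rw [FirstOrder.Language.Formula.realize_iExs]
  constructor
  · rintro ⟨i, hi⟩
    exact ⟨i (), (hφ x _).1 hi⟩
  · rintro ⟨a, ha⟩
    exact ⟨fun _ => a, (hφ x _).2 ha⟩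

/-- Universal quantification over elements of the universe. -/
theorem all {R : ∀ x, (α → Fin (F x).card) → Fin (F x).card → Prop}
    (h : FODefinable F (α := α ⊕ Unit) fun x w => R x (w ∘ Sum.inl) (w (Sum.inr ()))) :
    FODefinable F (fun x v => ∀ a, R x v a) := by
  refine (not (ex (R := fun x v a => ¬ R x v a) (not h))).congr fun x v => ?_
  simp

/-- Disjunction over a finite index set. -/
theorem finEx {ι : Type*} [Finite ι] {R : ι → ∀ x, (α → Fin (F x).card) → Prop}
    (h : ∀ i, FODefinable F (R i)) : FODefinable F (fun x v => ∃ i, R i x v) := by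
  choose φ hφ using h
  refine ⟨FirstOrder.Language.Formula.iSup φ, fun x v => ?_⟩
  let := (F x).str
  rw [FirstOrder.Language.Formula.realize_iSup]
  exact exists_congr fun i => hφ i x v

/-- Conjunction over a finite index set. -/
theorem finAll {ι : Type*} [Finite ι] {R : ι → ∀ x, (α → Fin (F x).card) → Prop}
    (h : ∀ i, FODefinable F (R i)) : FODefinable F (fun x v => ∀ i, R i x v) := by
  refine (not (finEx fun i => not (h i))).congr fun x v => ?_
  simp

/-- Renaming of variables. -/
theorem relabel (h : FODefinable F R) (f : α → β) :
    FODefinable F (fun x (w : β → Fin (F x).card) => R x (w ∘ f)) :=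
  let ⟨φ, hφ⟩ := h
  ⟨FirstOrder.Language.Formula.relabel f φ, fun x v => by
    let := (F x).str
    rw [FirstOrder.Language.Formula.realize_relabel, hφ]⟩

theorem eq (a b : α) : FODefinable F (fun x v => v a = v b) :=
  ⟨FirstOrder.Language.Term.equal (FirstOrder.Language.var a) (FirstOrder.Language.var b), fun x v =>
    let := (F x).str
    FirstOrder.Language.Formula.realize_equal.trans Iff.rfl⟩

/-- Atomic formulas over the vocabulary of the structures. -/
theorem rel {n : ℕ} (r : σ.Relations n) (a : Fin n → α) :
    FODefinable F (fun x v => (F x).Rel r (fun i => v (a i))) :=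
  ⟨FirstOrder.Language.Relations.formula (L := numLang.sum σ) (Sum.inr r) fun i => FirstOrder.Language.var (a i),
    fun x v =>
      let := (F x).str
      FirstOrder.Language.Formula.realize_rel.trans Iff.rfl⟩

theorem num {n : ℕ} (r : NumRel n) (a : Fin n → α) :
    FODefinable F (fun x v => (numStructure (F x).card).RelMap r (fun i => v (a i))) :=
  ⟨FirstOrder.Language.Relations.formula (L := numLang.sum σ) (Sum.inl r) fun i => FirstOrder.Language.var (a i),
    fun x v =>
      let := (F x).str
      FirstOrder.Language.Formula.realize_rel.trans Iff.rfl⟩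

theorem lt (a b : α) : FODefinable F (fun _ v => (v a : ℕ) < v b) :=
  num NumRel.lt ![a, b]

theorem add (a b c : α) : FODefinable F (fun _ v => (v a : ℕ) + v b = v c) :=
  num NumRel.add ![a, b, c]

theorem mul (a b c : α) : FODefinable F (fun _ v => (v a : ℕ) * v b = v c) :=
  num NumRel.mul ![a, b, c]

theorem testBit (a b : α) : FODefinable F (fun _ v => (v a : ℕ).testBit (v b) = true) :=
  num NumRel.bit ![a, b]

theorem zero (a : α) : FODefinable F (fun _ v => (v a : ℕ) = 0) :=
  (add a a a).congr fun x v => by omega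

theorem one (a : α) : FODefinable F (fun _ v => (v a : ℕ) = 1) :=
  ((mul a a a).and (zero a).not).congr fun x v => by
    constructor
    · rintro ⟨h, h0⟩
      exact Nat.eq_of_mul_eq_mul_left (Nat.pos_of_ne_zero h0) (by rw [h, mul_one])
    · intro h; simp [h]

theorem succ (a b : α) : FODefinable F (fun _ v => (v a : ℕ) + 1 = v b) := by
  refine (ex (R := fun x v c => (c : ℕ) = 1 ∧ (v a : ℕ) + c = v b)
    ((one (Sum.inr ())).and (add (Sum.inl a) (Sum.inr ()) (Sum.inl b)))).congr fun x v => ?_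
  constructor
  · rintro ⟨c, h1, h2⟩; omega
  · intro h
    have := (v b).isLt
    -- The element 1 exists because `v a + 1` is itself an element of the universe.
    exact ⟨⟨1, by omega⟩, rfl, h⟩

theorem last (a : α) : FODefinable F (fun x v => (v a : ℕ) + 1 = (F x).card) := by
  refine (not (ex (R := fun x v c => (v a : ℕ) < c)
    (lt (Sum.inl a) (Sum.inr ())))).congr fun x v => ?_
  constructor
  · intro h
    by_contra hne
    exact h ⟨⟨v a + 1, by have := (v a).isLt; omega⟩, by simp⟩
  · rintro h ⟨c, hc⟩
    have := c.isLt
    omega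

end FODefinable

/-! ### Forests have tree-width at most one -/

section Forest

variable {V : Type*}

/-- The tree obtained from a forest, given by its parent function, by adding a common root. -/
def rootedTree (par : V → Option V) : SimpleGraph (Option V) :=
  SimpleGraph.fromRel fun a b => ∃ v, a = some v ∧ b = par v

variable {par : V → Option V} {rank : V → ℕ} {B : ℕ}

theorem rootedTree_adj_par (h : ∀ v w, par v = some w → rank v < rank w) (v : V) :
    (rootedTree par).Adj (some v) (par v) := by
  refine (SimpleGraph.fromRel_adj _ _ _).2 ⟨fun e => ?_, Or.inl ⟨v, rfl, rfl⟩⟩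
  exact lt_irrefl _ (h v v e.symm)

theorem rootedTree_reachable (h : ∀ v w, par v = some w → rank v < rank w)
    (hB : ∀ v, rank v < B) (v : V) : (rootedTree par).Reachable (some v) none := by
  induction hn : B - rank v using Nat.strong_induction_on generalizing v with
  | _ n ih =>
    have hadj := (rootedTree_adj_par h v).reachable
    cases hp : par v with
    | none => rwa [hp] at hadj
    | some w =>
      rw [hp] at hadj
      have := h v w hp
      have := hB w
      exact hadj.trans (ih (B - rank w) (by omega) w rfl)

theorem rootedTree_isTree [Finite V] (h : ∀ v w, par v = some w → rank v < rank w)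
    (hB : ∀ v, rank v < B) : (rootedTree par).IsTree := by
  have hc : (rootedTree par).Connected := by
    have hr : ∀ a, (rootedTree par).Reachable a none := by
      rintro (_ | v)
      · rfl
      · exact rootedTree_reachable h hB v
    exact ⟨fun a b => (hr a).trans (hr b).symm⟩
  refine SimpleGraph.isTree_iff_connected_and_card.2 ⟨hc, le_antisymm ?_
    hc.card_vert_le_card_edgeSet_add_one⟩
  -- Each edge joins some `v` to its parent, so there are at most as many edges as non-root
  -- vertices; a connected graph with so few edges is a tree.
  have hsub : (rootedTree par).edgeSet ⊆ Set.range fun v => s(some v, par v) := by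
    intro e
    induction e using Sym2.ind with
    | _ a b =>
      intro he
      obtain ⟨-, ⟨v, rfl, rfl⟩ | ⟨v, rfl, rfl⟩⟩ :=
        (SimpleGraph.fromRel_adj _ _ _).1 (SimpleGraph.mem_edgeSet _ |>.1 he)
      · exact ⟨v, rfl⟩
      · exact ⟨v, Sym2.eq_swap⟩
  rw [Finite.card_option]
  refine Nat.succ_le_succ ((Nat.card_mono (Set.finite_range _) hsub).trans ?_)
  exact Finite.card_range_le _

/-- Some walk from `i` to `j` uses only these vertices, and paths in an acyclic graph are unique.
This gives the convexity condition when the nodes whose bags contain a vertex form a star. -/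
theorem _root_.SimpleGraph.IsAcyclic.support_subset_of_center {W : Type*} {T : SimpleGraph W}
    (hT : T.IsAcyclic) {i j c : W} (hi : i = c ∨ T.Adj i c) (hj : j = c ∨ T.Adj j c)
    (p : T.Walk i j) (hp : p.IsPath) : ∀ l ∈ p.support, l = i ∨ l = c ∨ l = j := by
  classical
  have hq : ∃ q : T.Walk i j, ∀ l ∈ q.support, l = i ∨ l = c ∨ l = j := by
    rcases hi with rfl | hi <;> rcases hj with rfl | hj
    · exact ⟨.nil, by simp⟩
    · exact ⟨.cons hj.symm .nil, by simp⟩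
    · exact ⟨.cons hi .nil, by simp⟩
    · exact ⟨.cons hi (.cons hj.symm .nil), by simp⟩
  obtain ⟨q, hq⟩ := hq
  have e : (⟨p, hp⟩ : T.Path i j) = q.toPath :=
    (hT.subsingleton_path i j).elim _ _
  intro l hl
  refine hq l (q.support_bypass_subset_support ?_)
  have e' : p = q.bypass := congrArg Subtype.val e
  rwa [← e']

-- The decomposition tree is the forest with an added root; the bag of `u` is `u` with its parent,
-- and the root has an empty bag. The nodes whose bags contain `v` are `v` and its children, a star
-- with centre `v`.
open Classical in
theorem treewidth_le_one_of_parent [Fintype V] {G : SimpleGraph V}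
    (hG : ∀ u v, G.Adj u v → par u = some v ∨ par v = some u)
    (h : ∀ v w, par v = some w → rank v < rank w) (hB : ∀ v, rank v < B) :
    treewidth G ≤ 1 := by
  let e : Fin (Fintype.card (Option V)) ≃ Option V := (Fintype.equivFin _).symm
  let bag : Option V → Finset V := fun a => a.elim ∅ fun u => insert u (par u).toFinset
  have hbag : ∀ a v, v ∈ bag a ↔ ∃ u, a = some u ∧ (v = u ∨ par u = some v) := by
    rintro (_ | u) v
    · simp [bag]
    · simp [bag]
  have iso : (rootedTree par).comap e ≃g rootedTree par := SimpleGraph.Iso.comap e _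
  have hT : ((rootedTree par).comap e).IsTree :=
    iso.isTree_iff.2 (rootedTree_isTree h hB)
  have hcenter : ∀ v i, v ∈ bag (e i) →
      i = e.symm (some v) ∨ ((rootedTree par).comap e).Adj i (e.symm (some v)) := by
    intro v i hi
    obtain ⟨u, hu, rfl | hp⟩ := (hbag _ _).1 hi
    · left; rw [← hu, Equiv.symm_apply_apply]
    · right
      rw [SimpleGraph.comap_adj, Equiv.apply_symm_apply, hu, ← hp]
      exact rootedTree_adj_par h u
  let D : TreeDecomposition G :=
    { size := _
      tree := (rootedTree par).comap e
      isTree := hT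
      bag := fun i => bag (e i)
      cover := fun v => ⟨e.symm (some v), (hbag _ _).2 ⟨v, by simp, Or.inl rfl⟩⟩
      convex := by
        intro v i j p hp hi hj l hl
        rcases hT.isAcyclic.support_subset_of_center (hcenter v i hi) (hcenter v j hj) p hp l hl
          with rfl | rfl | rfl
        · exact hi
        · exact (hbag _ _).2 ⟨v, by simp, Or.inl rfl⟩
        · exact hj
      edge := by
        intro u v huv
        rcases hG u v huv with hp | hp
        · exact ⟨e.symm (some u), (hbag _ _).2 ⟨u, by simp, Or.inl rfl⟩,
            (hbag _ _).2 ⟨u, by simp, Or.inr hp⟩⟩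
        · exact ⟨e.symm (some v), (hbag _ _).2 ⟨v, by simp, Or.inr hp⟩,
            (hbag _ _).2 ⟨v, by simp, Or.inl rfl⟩⟩ }
  have hD : D.width ≤ 1 := by
    refine Finset.sup_le fun i _ => ?_
    have : (bag (e i)).card ≤ 2 := by
      cases e i with
      | none => simp [bag]
      | some u =>
        refine (Finset.card_insert_le _ _).trans ?_
        cases par u <;> simp
    change (bag (e i)).card - 1 ≤ 1
    omega
  exact (Nat.sInf_le (Set.mem_range_self D)).trans hD

end Forest

/-! ### Powers of adjacency matrices of functional graphs -/

section Functional

variable {V : Type*} {R : V → V → Prop} {rank : V → ℕ} {B : ℕ}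

theorem treewidth_supportGraph_le_one [Fintype V] {A : Matrix V V ℤ}
    (hA : ∀ u v, A u v ≠ 0 → R u v) (huniq : ∀ u v w, R u v → R u w → v = w)
    (hrank : ∀ u v, R u v → u = v ∨ rank u < rank v) (hB : ∀ v, rank v < B) :
    treewidth (supportGraph A) ≤ 1 := by
  classical
  let par : V → Option V := fun u => if h : ∃ v, u ≠ v ∧ R u v then some h.choose else none
  have hpar : ∀ u v, u ≠ v → R u v → par u = some v := by
    intro u v hne huv
    have h : ∃ v, u ≠ v ∧ R u v := ⟨v, hne, huv⟩
    simp only [par, dif_pos h, Option.some.injEq]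
    exact huniq u _ _ h.choose_spec.2 huv
  have hpar' : ∀ u v, par u = some v → rank u < rank v := by
    intro u v he
    by_cases h : ∃ v, u ≠ v ∧ R u v
    · simp only [par, dif_pos h, Option.some.injEq] at he
      have := h.choose_spec
      rw [he] at this
      exact (hrank u v this.2).resolve_left this.1
    · simp [par, dif_neg h] at he
  refine treewidth_le_one_of_parent (par := par) (rank := rank) (B := B) ?_ hpar' hB
  intro u v huv
  obtain ⟨hne, h | h⟩ := (SimpleGraph.fromRel_adj _ _ _).1 huv
  · exact Or.inl (hpar u v hne (hA u v h))
  · exact Or.inr (hpar v u hne.symm (hA v u h))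

/-- `j` is reached from `i` in exactly `m` steps. -/
def StepsTo (R : V → V → Prop) : ℕ → V → V → Prop
  | 0, i, j => i = j
  | m + 1, i, j => ∃ k, R i k ∧ StepsTo R m k j

-- Each row has at most one nonzero entry, so the sum in the matrix product has at most one nonzero
-- term and a power only follows the unique walk.
open Classical in
theorem pow_apply_of_functional [Fintype V] [DecidableEq V] {A : Matrix V V ℤ}
    (hA : ∀ u v, A u v = if R u v then 1 else 0) (huniq : ∀ u v w, R u v → R u w → v = w)
    (m : ℕ) (i j : V) : (A ^ m) i j = if StepsTo R m i j then 1 else 0 := by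
  induction m generalizing i with
  | zero =>
    rw [pow_zero, Matrix.one_apply]
    exact if_congr Iff.rfl rfl rfl
  | succ m ih =>
    rw [pow_succ', Matrix.mul_apply]
    simp only [hA, ih, ite_mul, one_mul, zero_mul]
    by_cases h : ∃ k, R i k
    · obtain ⟨k, hk⟩ := h
      have hk' : ∀ l, R i l ↔ l = k := fun l => ⟨fun hl => huniq i l k hl hk, fun e => e ▸ hk⟩
      simp [StepsTo, hk']
    · have hk' : ∀ l, ¬ R i l := fun l hl => h ⟨l, hl⟩
      simp [StepsTo, hk']

theorem StepsTo.reflTransGen {m : ℕ} {i j : V} (h : StepsTo R m i j) :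
    Relation.ReflTransGen R i j := by
  induction m generalizing i with
  | zero => cases h; rfl
  | succ m ih =>
    obtain ⟨k, hk, h⟩ := h
    exact (ih h).head hk

theorem StepsTo.eq_of_loop (huniq : ∀ u v w, R u v → R u w → v = w) {m : ℕ} {i j : V}
    (h : StepsTo R m i j) (hi : R i i) : i = j := by
  induction m with
  | zero => exact h
  | succ m ih =>
    obtain ⟨k, hk, h⟩ := h
    cases huniq _ _ _ hi hk
    exact ih h

/-- Once a walk takes a loop, determinism keeps it there to the end; a walk that takes none gains at
least one rank per step. -/
theorem StepsTo.loop_or_rank (huniq : ∀ u v w, R u v → R u w → v = w)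
    (hrank : ∀ u v, R u v → u = v ∨ rank u < rank v) {m : ℕ} {i j : V}
    (h : StepsTo R m i j) : R j j ∨ m + rank i ≤ rank j := by
  induction m generalizing i with
  | zero => cases h; simp
  | succ m ih =>
    obtain ⟨k, hk, h⟩ := h
    rcases hrank _ _ hk with rfl | hlt
    · have := h.eq_of_loop huniq hk
      exact Or.inl (this ▸ hk)
    · rcases ih h with hj | hle
      · exact Or.inl hj
      · right; omega

theorem stepsTo_of_loop {m : ℕ} {j : V} (h : R j j) : StepsTo R m j j := by
  induction m with
  | zero => rfl
  | succ m ih => exact ⟨j, h, ih⟩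

/-- Loop edges along the way can be dropped, leaving at most `rank j - rank i` steps; the loop at
`j` pads the walk to the prescribed length. -/
theorem stepsTo_of_reflTransGen
    (hrank : ∀ u v, R u v → u = v ∨ rank u < rank v) {i j : V}
    (h : Relation.ReflTransGen R i j) (hj : R j j) :
    rank i ≤ rank j ∧ ∀ m, rank j ≤ m + rank i → StepsTo R m i j := by
  induction h using Relation.ReflTransGen.head_induction_on with
  | refl => exact ⟨le_rfl, fun m _ => stepsTo_of_loop hj⟩
  | @head i k hik _ ih =>
    rcases hrank _ _ hik with rfl | hlt
    · exact ih
    · refine ⟨hlt.le.trans ih.1, fun m hm => ?_⟩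
      obtain ⟨m, rfl⟩ : ∃ l, m = l + 1 := ⟨m - 1, by have := ih.1; omega⟩
      exact ⟨k, hik, ih.2 m (by omega)⟩

theorem stepsTo_iff (huniq : ∀ u v w, R u v → R u w → v = w)
    (hrank : ∀ u v, R u v → u = v ∨ rank u < rank v) {m : ℕ} (hm : ∀ v, rank v < m) {i j : V} :
    StepsTo R m i j ↔ Relation.ReflTransGen R i j ∧ R j j := by
  constructor
  · intro h
    refine ⟨h.reflTransGen, (h.loop_or_rank huniq hrank).resolve_right ?_⟩
    have := hm j
    omega
  · rintro ⟨h, hj⟩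
    exact (stepsTo_of_reflTransGen hrank h hj).2 m (by have := hm j; omega)

end Functional

/-! ### Reductions to matrix powering given by definable forests -/

section Instance

open PowInstance

variable {S : FinStr powLang} {R : Fin S.card → Fin S.card → Prop} {rank : Fin S.card → ℕ}
  {i j : Fin S.card} {k : ℕ}

open Classical in
theorem matrix_eq_of_entryBit (hneg : ∀ p q, ¬ S.Rel PowRel.entryNeg ![p, q])
    (hbit : ∀ p q b, S.Rel PowRel.entryBit ![p, q, b] ↔ R p q ∧ (b : ℕ) = 0) (p q : Index S) :
    matrix S p q = if R p.1 q.1 then 1 else 0 := by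
  have hpos : 0 < S.card := p.1.pos
  simp only [matrix, hneg, hbit, if_false, one_mul]
  by_cases h : R p.1 q.1
  · rw [Finset.sum_eq_single (⟨0, hpos⟩ : Fin S.card)]
    · simp [h]
    · intro b _ hb
      exact if_neg fun h' => hb (Fin.ext h'.2)
    · simp
  · simp [h]

theorem stepsTo_index (hdim : ∀ p, S.Rel PowRel.dim ![p]) (m : ℕ) (p q : Index S) :
    StepsTo (fun p q : Index S => R p.1 q.1) m p q ↔ StepsTo R m p.1 q.1 := by
  induction m generalizing p with
  | zero => exact Subtype.ext_iff
  | succ m ih =>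
    constructor
    · rintro ⟨l, hl, h⟩
      exact ⟨l.1, hl, (ih l).1 h⟩
    · rintro ⟨l, hl, h⟩
      exact ⟨⟨l, hdim l⟩, hl, (ih ⟨l, hdim l⟩).2 h⟩

/-- An instance whose matrix is the adjacency matrix of a forest with edges oriented towards the
roots, some of which carry loops. -/
theorem forest_instance (hk : 1 ≤ k)
    (hdim : ∀ p, S.Rel PowRel.dim ![p]) (hexp : ∀ p, S.Rel PowRel.exponent ![p])
    (hposn : ∀ p, ¬ S.Rel PowRel.position ![p])
    (hneg : ∀ p q, ¬ S.Rel PowRel.entryNeg ![p, q])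
    (hbit : ∀ p q b, S.Rel PowRel.entryBit ![p, q, b] ↔ R p q ∧ (b : ℕ) = 0)
    (hrow : ∀ p, S.Rel PowRel.row ![p] ↔ p = i) (hcol : ∀ p, S.Rel PowRel.col ![p] ↔ p = j)
    (huniq : ∀ u v w, R u v → R u w → v = w)
    (hrank : ∀ u v, R u v → u = v ∨ rank u < rank v) (hB : ∀ v, rank v < S.card) :
    S ∈ (matrixPowering k).legal ∧
      (S ∈ (matrixPowering k).yes ↔ Relation.ReflTransGen R i j ∧ R j j) := by
  classical
  have hA := matrix_eq_of_entryBit hneg hbit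
  have huniq' : ∀ u v w : Index S, R u.1 v.1 → R u.1 w.1 → v = w :=
    fun u v w h h' => Subtype.ext (huniq _ _ _ h h')
  have hlegal : WellFormed S ∧ treewidth (supportGraph (matrix S)) ≤ k := by
    refine ⟨⟨fun _ _ _ _ => hdim _, fun _ _ _ _ => hexp _, fun _ b _ h => absurd h (hposn _),
      ⟨i, (hrow i).2 rfl, fun p hp => (hrow p).1 hp⟩, ⟨j, (hcol j).2 rfl, fun p hp => (hcol p).1 hp⟩,
      fun p _ => hdim p, fun p _ => hdim p⟩, le_trans ?_ hk⟩
    refine treewidth_supportGraph_le_one (R := fun p q : Index S => R p.1 q.1)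
      (rank := fun p => rank p.1) (B := S.card) ?_ huniq' ?_ fun v => hB v.1
    · intro u v h
      rw [hA] at h
      by_contra h'
      exact h (if_neg h')
    · intro u v h
      exact (hrank _ _ h).imp_left Subtype.ext
  refine ⟨hlegal, ?_⟩
  -- The exponent is the size of the universe, which exceeds every rank, as `stepsTo_iff` demands.
  have hm : exponent S = S.card := by
    have : {p | S.Rel PowRel.exponent ![p]} = Set.univ := Set.eq_univ_of_forall hexp
    rw [exponent, this, Set.ncard_univ, Nat.card_eq_fintype_card, Fintype.card_fin]
  have hb : position S = 0 := by
    have : {p | S.Rel PowRel.position ![p]} = ∅ := Set.eq_empty_of_forall_notMem hposn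
    rw [position, this, Set.ncard_empty]
  have key : ∀ p q : Index S, ((matrix S ^ exponent S) p q).natAbs.testBit (position S) = true ↔
      Relation.ReflTransGen R p.1 q.1 ∧ R q.1 q.1 := by
    intro p q
    rw [pow_apply_of_functional (R := fun p q : Index S => R p.1 q.1) hA huniq', hm, hb,
      stepsTo_index hdim, ← stepsTo_iff huniq hrank hB]
    by_cases h : StepsTo R S.card p.1 q.1 <;> simp [h]
  constructor
  · rintro ⟨-, p, q, hp, hq, h⟩
    rw [key, (hrow _).1 hp, (hcol _).1 hq] at h
    exact h
  · intro h
    exact ⟨hlegal, ⟨i, hdim i⟩, ⟨j, hdim j⟩, (hrow i).2 rfl, (hcol j).2 rfl, (key _ _).2 h⟩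

end Instance

/-- One formula per symbol serves all structures `F x` and all parameters, so building a query
amounts to proving its relations definable. -/
theorem exists_query_of_definable {σ τ : FirstOrder.Language.{0, 0}} [τ.IsRelational] {X : Type*}
    {F : X → FinStr σ} {d r : ℕ}
    (Q : ∀ {a : ℕ}, τ.Relations a → ∀ x, (Fin d ⊕ (Fin a × Fin r) → Fin (F x).card) → Prop)
    (hQ : ∀ {a : ℕ} (s : τ.Relations a), FODefinable F (Q s)) :
    ∃ I : FOQuery σ τ d r, ∀ (x : X) (z : Fin d → Fin (F x).card) {a : ℕ} (s : τ.Relations a)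
      (v : Fin a → Fin (I.output (F x) z).card),
      (I.output (F x) z).Rel s v ↔ Q s x (Sum.elim z fun p =>
        (finFunctionFinEquiv.symm (v p.1) : Fin r → Fin (F x).card) p.2) := by
  choose φ hφ using @hQ
  exact ⟨⟨fun s => φ s⟩, fun x z a s v => hφ s x _⟩

/-! ### The general reduction principle for definable forests -/

section Reduction

variable {σ : FirstOrder.Language.{0, 0}} {X : Type*} {F : X → FinStr σ} {ι : Type} [Fintype ι]
  {d : ℕ}

/-- The meaning of the symbols in the instance given by `Step`, `Row` and `Col`; the variables of
the `i`-th block are indexed by `ι` through `e`. -/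
def forestQuery (e : Fin (Fintype.card ι) ≃ ι)
    (Step : ∀ x, (ι → Fin (F x).card) → (ι → Fin (F x).card) → Prop)
    (Row : ∀ x, (ι → Fin (F x).card) → Prop)
    (Col : ∀ x, (Fin d → Fin (F x).card) → (ι → Fin (F x).card) → Prop) :
    ∀ {a : ℕ}, PowRel a → ∀ x, (Fin d ⊕ (Fin a × Fin (Fintype.card ι)) → Fin (F x).card) → Prop
  | _, PowRel.dim => fun _ _ => True
  | _, PowRel.exponent => fun _ _ => True
  | _, PowRel.position => fun _ _ => False
  | _, PowRel.entryNeg => fun _ _ => False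
  | _, PowRel.entryBit => fun x w =>
      Step x (fun k => w (Sum.inr (0, e.symm k))) (fun k => w (Sum.inr (1, e.symm k))) ∧
        ∀ l, (w (Sum.inr (2, l)) : ℕ) = 0
  | _, PowRel.row => fun x w => Row x (fun k => w (Sum.inr (0, e.symm k)))
  | _, PowRel.col => fun x w => Col x (fun l => w (Sum.inl l)) (fun k => w (Sum.inr (0, e.symm k)))

theorem forestQuery_definable (e : Fin (Fintype.card ι) ≃ ι)
    {Step : ∀ x, (ι → Fin (F x).card) → (ι → Fin (F x).card) → Prop}
    {Row : ∀ x, (ι → Fin (F x).card) → Prop}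
    {Col : ∀ x, (Fin d → Fin (F x).card) → (ι → Fin (F x).card) → Prop}
    (hStep : FODefinable F (α := ι ⊕ ι) fun x w => Step x (w ∘ Sum.inl) (w ∘ Sum.inr))
    (hRow : FODefinable F Row)
    (hCol : FODefinable F (α := Fin d ⊕ ι) fun x w => Col x (w ∘ Sum.inl) (w ∘ Sum.inr))
    {a : ℕ} (s : PowRel a) : FODefinable F (forestQuery e Step Row Col s) := by
  cases s with
  | dim => exact FODefinable.const True
  | exponent => exact FODefinable.const True
  | position => exact FODefinable.const False
  | entryNeg => exact FODefinable.const False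
  | entryBit =>
    exact (hStep.relabel (Sum.elim (fun k => Sum.inr (0, e.symm k))
      (fun k => Sum.inr (1, e.symm k)))).and
      (FODefinable.finAll fun l => FODefinable.zero (Sum.inr (2, l)))
  | row => exact hRow.relabel fun k => Sum.inr (0, e.symm k)
  | col => exact hCol.relabel (Sum.elim Sum.inl fun k => Sum.inr (0, e.symm k))

/-- A problem reduces to matrix powering if its instances define, uniformly by first-order
formulas, forests on the `ι`-tuples such that acceptance is equivalent to the reachability of a
node with a loop. -/
theorem reducible_of_definable_forest {P : Problem σ} {k : ℕ} (hk : 1 ≤ k)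
    (hF : P.legal ⊆ Set.range F) (hcard : ∀ x, 0 < (F x).card)
    (Step : ∀ x, (ι → Fin (F x).card) → (ι → Fin (F x).card) → Prop)
    (Row : ∀ x, (ι → Fin (F x).card) → Prop)
    (Col : ∀ x, (Fin d → Fin (F x).card) → (ι → Fin (F x).card) → Prop)
    (rank : ∀ x, (ι → Fin (F x).card) → ℕ)
    (hStep : FODefinable F (α := ι ⊕ ι) fun x w => Step x (w ∘ Sum.inl) (w ∘ Sum.inr))
    (hRow : FODefinable F Row)
    (hCol : FODefinable F (α := Fin d ⊕ ι) fun x w => Col x (w ∘ Sum.inl) (w ∘ Sum.inr))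
    (hRow' : ∀ x, ∃! u, Row x u) (hCol' : ∀ x z, ∃! u, Col x z u)
    (huniq : ∀ x u v w, Step x u v → Step x u w → v = w)
    (hrank : ∀ x u v, Step x u v → u = v ∨ rank x u < rank x v)
    (hB : ∀ x u, rank x u < (F x).card ^ Fintype.card ι)
    (hyes : ∀ x, F x ∈ P.yes ↔ ∃ z u v, Row x u ∧ Col x z v ∧
      Relation.ReflTransGen (Step x) u v ∧ Step x v v) :
    FODisjunctiveReducible P (matrixPowering k) := by
  let e : Fin (Fintype.card ι) ≃ ι := (Fintype.equivFin ι).symm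
  obtain ⟨I, hI⟩ := exists_query_of_definable (τ := powLang) (F := F)
    (fun s => forestQuery e Step Row Col s) (fun s => forestQuery_definable e hStep hRow hCol s)
  have main : ∀ x z, I.output (F x) z ∈ (matrixPowering k).legal ∧
      (I.output (F x) z ∈ (matrixPowering k).yes ↔ ∃ u v, Row x u ∧ Col x z v ∧
        Relation.ReflTransGen (Step x) u v ∧ Step x v v) := by
    intro x z
    let T : Fin (I.output (F x) z).card ≃ (ι → Fin (F x).card) :=
      finFunctionFinEquiv.symm.trans (e.arrowCongr (Equiv.refl _))
    obtain ⟨i, hi, hi'⟩ := hRow' x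
    obtain ⟨j, hj, hj'⟩ := hCol' x z
    -- A tuple is numbered 0 iff all its digits vanish, so the condition on the third block selects
    -- the bit of weight 1.
    have hzero : ∀ b : Fin (I.output (F x) z).card,
        (∀ l, ((finFunctionFinEquiv.symm b : Fin (Fintype.card ι) → Fin (F x).card) l : ℕ) = 0) ↔
          (b : ℕ) = 0 := by
      intro b
      obtain ⟨f, rfl⟩ := (finFunctionFinEquiv (m := (F x).card)).surjective b
      rw [Equiv.symm_apply_apply, finFunctionFinEquiv_apply]
      have := hcard x
      simp [Finset.sum_eq_zero_iff, this.ne']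
    have := forest_instance (S := I.output (F x) z) (R := fun p q => Step x (T p) (T q))
      (rank := fun p => rank x (T p)) (i := T.symm i) (j := T.symm j) hk
      (fun p => (hI x z (a := 1) PowRel.dim _).2 trivial)
      (fun p => (hI x z (a := 1) PowRel.exponent _).2 trivial)
      (fun p h => (hI x z (a := 1) PowRel.position _).1 h)
      (fun p q h => (hI x z (a := 2) PowRel.entryNeg _).1 h)
      (fun p q b => (hI x z (a := 3) PowRel.entryBit _).trans (and_congr Iff.rfl (hzero b)))
      (fun p => (hI x z (a := 1) PowRel.row _).trans
        ⟨fun h => (Equiv.eq_symm_apply T).2 (hi' _ h), fun h => (congrArg (Row x) ((Equiv.eq_symm_apply T).1 h)).mpr hi⟩)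
      (fun p => (hI x z (a := 1) PowRel.col _).trans
        ⟨fun h => (Equiv.eq_symm_apply T).2 (hj' _ h), fun h => (congrArg (Col x z) ((Equiv.eq_symm_apply T).1 h)).mpr hj⟩)
      (fun u v w h h' => T.injective (huniq x _ _ _ h h'))
      (fun u v h => (hrank x _ _ h).imp_left fun h => T.injective h)
      (fun v => hB x _)
    refine ⟨this.1, this.2.trans ?_⟩
    have hlift : Relation.ReflTransGen (fun p q => Step x (T p) (T q)) (T.symm i) (T.symm j) ↔
        Relation.ReflTransGen (Step x) i j := by
      constructor
      · intro h
        have := h.lift (p := Step x) T fun _ _ h => h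
        simpa [Function.onFun] using this
      · intro h
        exact h.lift T.symm fun a b h => by simpa [Function.onFun] using h
    rw [hlift, Equiv.apply_symm_apply]
    constructor
    · exact fun h => ⟨i, j, hi, hj, h⟩
    · rintro ⟨u, v, hu, hv, h⟩
      rwa [hi' u hu, hj' v hv] at h
  refine ⟨d, Fintype.card ι, I, fun S hS => ?_⟩
  obtain ⟨x, rfl⟩ := hF hS
  exact ⟨fun z => (main x z).1, (hyes x).trans (exists_congr fun z => (main x z).2.symm)⟩

end Reduction

/-! ### Directed paths -/

section DirectedPath

variable {V : Type*} {E : V → V → Prop}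

theorem IsDirectedPath.exists_rank (h : IsDirectedPath E) : ∃ rank : V → ℕ,
    Function.Injective rank ∧ (∀ v, rank v < Nat.card V) ∧ ∀ u v, E u v ↔ rank u + 1 = rank v := by
  obtain ⟨n, e, he⟩ := h
  refine ⟨fun v => e.symm v, fun u v huv => e.symm.injective (Fin.ext huv), fun v => ?_,
    fun u v => ?_⟩
  · rw [← Nat.card_congr e, Nat.card_fin]
    exact (e.symm v).isLt
  · rw [← he, Equiv.apply_symm_apply, Equiv.apply_symm_apply]

open Classical in
theorem pow_one_add_adjacency_nonneg [Fintype V] [DecidableEq V] (m : ℕ) (s t : V) :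
    0 ≤ ((1 + adjacency E) ^ m) s t := by
  induction m generalizing s with
  | zero => rw [pow_zero, Matrix.one_apply]; split_ifs <;> simp
  | succ m ih =>
    rw [pow_succ', Matrix.mul_apply]
    refine Finset.sum_nonneg fun k _ => mul_nonneg ?_ (ih k)
    rw [Matrix.add_apply, Matrix.one_apply, adjacency]
    split_ifs <;> simp

/-- All terms of the matrix product are nonnegative, so a sum is nonzero as soon as one term is; the
nonzero entries of `1 + A` are the lazy steps. -/
theorem pow_one_add_adjacency_ne_zero [Fintype V] [DecidableEq V] (m : ℕ) (s t : V) :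
    ((1 + adjacency E) ^ m) s t ≠ 0 ↔ StepsTo (Relation.ReflGen E) m s t := by
  classical
  induction m generalizing s with
  | zero => simp [StepsTo, Matrix.one_apply]
  | succ m ih =>
    have hentry : ∀ k, (1 + adjacency E) s k ≠ 0 ↔ Relation.ReflGen E s k := by
      intro k
      rw [Matrix.add_apply, Matrix.one_apply, adjacency, Relation.reflGen_iff]
      split_ifs <;> simp_all [eq_comm]
    have hnn := pow_one_add_adjacency_nonneg (E := E) (V := V)
    rw [pow_succ', Matrix.mul_apply, ne_eq, Finset.sum_eq_zero_iff_of_nonneg]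
    · simp only [Finset.mem_univ, true_implies, not_forall, mul_eq_zero, not_or]
      exact exists_congr fun k => and_congr (hentry k) (ih k)
    · intro k _
      refine mul_nonneg ?_ (hnn m k t)
      simpa using hnn 1 s k

/-- In the lazy relation every vertex has a loop, so a path can be padded to any length that is at
least the rank difference; positions on the path are below the number of vertices. -/
theorem IsDirectedPath.reachable_iff_pow_ne_zero [Fintype V] [DecidableEq V]
    (h : IsDirectedPath E) (s t : V) : Relation.ReflTransGen E s t ↔
      ((1 + adjacency E) ^ Fintype.card V) s t ≠ 0 := by
  obtain ⟨rank, -, hlt, hE⟩ := h.exists_rank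
  rw [pow_one_add_adjacency_ne_zero]
  have hrank : ∀ u v, Relation.ReflGen E u v → u = v ∨ rank u < rank v := by
    rintro u v (_ | huv)
    · exact Or.inl rfl
    · have := (hE u v).1 huv
      right; omega
  constructor
  · intro h
    refine (stepsTo_of_reflTransGen hrank (Relation.ReflTransGen.mono (fun _ _ h => .single h) _ _ h) .refl).2 _ ?_
    have := hlt t
    rw [Nat.card_eq_fintype_card] at this
    omega
  · intro h
    have := h.reflTransGen
    rwa [Relation.reflTransGen_reflGen] at this

end DirectedPath

/-! ### The reduction from `ORD` -/

/-- The edge out of the target is replaced by a loop, which marks the target and keeps out-degree at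
most one. The target is part of the input, so no parameters are needed. -/
theorem ord_reducible {k : ℕ} (hk : 1 ≤ k) :
    FODisjunctiveReducible ORD (matrixPowering k) := by
  let F : ORD.legal → FinStr ordLang := Subtype.val
  choose rank hinj hlt hE using fun x : ORD.legal => IsDirectedPath.exists_rank x.2.1
  let Src : ∀ x, Fin (F x).card → Prop := fun x u => (F x).Rel OrdRel.source ![u]
  let Tgt : ∀ x, Fin (F x).card → Prop := fun x u => (F x).Rel OrdRel.target ![u]
  have hSrc : ∀ x, ∃! u, Src x u := fun x => x.2.2.1
  have hTgt : ∀ x, ∃! u, Tgt x u := fun x => x.2.2.2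
  let Edge : ∀ x, Fin (F x).card → Fin (F x).card → Prop :=
    fun x u v => (¬ Tgt x u ∧ (F x).Rel OrdRel.edge ![u, v]) ∨ (Tgt x u ∧ u = v)
  have tup : ∀ x, ∀ {Q : Fin (F x).card → Prop}, (∃! u, Q u) →
      ∃! u : Unit → Fin (F x).card, Q (u ()) := by
    rintro x Q ⟨u, hu, hu'⟩
    exact ⟨fun _ => u, hu, fun v hv => funext fun _ => hu' _ hv⟩
  have ext1 : ∀ {n : ℕ} {u v : Unit → Fin n}, u () = v () → u = v := fun h => funext fun _ => h
  have hSrcD : ∀ {α : Type} (a : α), FODefinable F fun x v => Src x (v a) := fun a =>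
    (FODefinable.rel OrdRel.source ![a]).congr fun x v => by
      rw [show (fun i => v ((![a] : Fin 1 → _) i)) = ![v a] by ext i; fin_cases i; rfl]
  have hTgtD : ∀ {α : Type} (a : α), FODefinable F fun x v => Tgt x (v a) := fun a =>
    (FODefinable.rel OrdRel.target ![a]).congr fun x v => by
      rw [show (fun i => v ((![a] : Fin 1 → _) i)) = ![v a] by ext i; fin_cases i; rfl]
  have hEdgeD : ∀ {α : Type} (a b : α),
      FODefinable F fun x v => (F x).Rel OrdRel.edge ![v a, v b] := fun a b =>
    (FODefinable.rel OrdRel.edge ![a, b]).congr fun x v => by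
      rw [show (fun i => v ((![a, b] : Fin 2 → _) i)) = ![v a, v b] by
        ext i; fin_cases i <;> rfl]
  have hstep : ∀ x u v, Edge x u v → u = v ∨ rank x u < rank x v := by
    rintro x u v (⟨-, h⟩ | ⟨-, h⟩)
    · have := (hE x u v).1 h
      right; omega
    · exact Or.inl h
  refine reducible_of_definable_forest (F := F) (ι := Unit) (d := 0) hk
    (fun S hS => ⟨⟨S, hS⟩, rfl⟩) (fun x => (hSrc x).choose.pos)
    (fun x u v => Edge x (u ()) (v ())) (fun x u => Src x (u ())) (fun x _ u => Tgt x (u ()))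
    (fun x u => rank x (u ()))
    ?_ (hSrcD ()) (hTgtD (Sum.inr ())) (fun x => tup x (hSrc x)) (fun x _ => tup x (hTgt x))
    ?_ (fun x u v h => (hstep x _ _ h).imp_left ext1) ?_ ?_
  · exact ((hTgtD (Sum.inl ())).not.and (hEdgeD (Sum.inl ()) (Sum.inr ()))).or
      ((hTgtD (Sum.inl ())).and (FODefinable.eq (Sum.inl ()) (Sum.inr ())))
  · rintro x u v w (⟨hn, h⟩ | ⟨ht, h⟩) (⟨hn', h'⟩ | ⟨ht', h'⟩)
    · refine ext1 (hinj x ?_)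
      rw [← (hE x _ _).1 h, ← (hE x _ _).1 h']
    · exact absurd ht' hn
    · exact absurd ht hn'
    · exact ext1 (h.symm.trans h')
  · intro x u
    simpa using hlt x (u ())
  · intro x
    -- Deleting edges that leave `t` does not affect whether `t` is reached: a path can be stopped
    -- at its first visit.
    have hreach : ∀ s t, Tgt x t → (Relation.ReflTransGen (Edge x) s t ↔
        Relation.ReflTransGen (fun u v => (F x).Rel OrdRel.edge ![u, v]) s t) := by
      intro s t ht
      constructor
      · intro h
        clear ht
        induction h with
        | refl => rfl
        | tail _ hbc ih =>
          rcases hbc with ⟨-, hbc⟩ | ⟨-, rfl⟩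
          · exact ih.tail hbc
          · exact ih
      · intro h
        induction h using Relation.ReflTransGen.head_induction_on with
        | refl => rfl
        | @head i l hil _ ih =>
          by_cases hi : Tgt x i
          · rw [(hTgt x).unique hi ht]
          · exact ih.head (Or.inl ⟨hi, hil⟩)
    have hlift : ∀ u v : Unit → Fin (F x).card,
        Relation.ReflTransGen (fun u v => Edge x (u ()) (v ())) u v ↔
          Relation.ReflTransGen (Edge x) (u ()) (v ()) := fun u v =>
      ⟨fun h => h.lift (fun u : Unit → Fin (F x).card => u ()) fun _ _ h => h,
        fun h => Relation.ReflTransGen.lift (p := fun u v : Unit → Fin (F x).card => Edge x (u ()) (v ()))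
          (fun a (_ : Unit) => a) (fun _ _ h => h) _ _ h⟩
    constructor
    · rintro ⟨-, s, t, hs, ht, h⟩
      exact ⟨Fin.elim0, fun _ => s, fun _ => t, hs, ht, (hlift _ _).2 ((hreach s t ht).2 h),
        Or.inr ⟨ht, rfl⟩⟩
    · rintro ⟨-, u, v, hu, hv, h, -⟩
      exact ⟨x.2, u (), v (), hu, hv, (hreach _ _ hv).1 ((hlift _ _).1 h)⟩

/-! ### Auxiliary facts -/

theorem mul_add_inj {P a b c d : ℕ} (hc : c < P) (hd : d < P) :
    a * P + c = b * P + d ↔ a = b ∧ c = d := by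
  constructor
  · intro h
    have hP : 0 < P := by omega
    have h1 := congrArg (· / P) h
    have h2 := congrArg (· % P) h
    simp only [Nat.mul_comm _ P, Nat.mul_add_div hP, Nat.div_eq_of_lt hc, Nat.div_eq_of_lt hd,
      Nat.mul_add_mod, Nat.mod_eq_of_lt hc, Nat.mod_eq_of_lt hd, add_zero] at h1 h2
    exact ⟨h1, h2⟩
  · rintro ⟨rfl, rfl⟩; rfl

theorem stepsTo_add {V : Type*} {R : V → V → Prop} {m n : ℕ} {a c : V} :
    StepsTo R (m + n) a c ↔ ∃ b, StepsTo R m a b ∧ StepsTo R n b c := by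
  induction m generalizing a with
  | zero => simp [StepsTo]
  | succ m ih =>
    rw [Nat.succ_add]
    simp only [StepsTo, ih]
    constructor
    · rintro ⟨k, hk, b, h, h'⟩
      exact ⟨b, ⟨k, hk, h⟩, h'⟩
    · rintro ⟨b, ⟨k, hk, h⟩, h'⟩
      exact ⟨k, hk, b, h, h'⟩

theorem exists_stepsTo_of_reflTransGen {V : Type*} {R : V → V → Prop} {a b : V}
    (h : Relation.ReflTransGen R a b) : ∃ m, StepsTo R m a b := by
  induction h using Relation.ReflTransGen.head_induction_on with
  | refl => exact ⟨0, rfl⟩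
  | head h _ ih =>
    obtain ⟨m, hm⟩ := ih
    exact ⟨m + 1, _, h, hm⟩

/-- A shortest path has no repeated vertices. -/
theorem exists_stepsTo_lt_card {V : Type*} [Fintype V] {R : V → V → Prop} {a b : V}
    (h : Relation.ReflTransGen R a b) : ∃ m < Fintype.card V, StepsTo R m a b := by
  classical
  have hex := exists_stepsTo_of_reflTransGen h
  set T := Nat.find hex with hT
  have hmin : ∀ m, StepsTo R m a b → T ≤ m := fun m hm => Nat.find_min' hex hm
  have hsplit : ∀ i : Fin (T + 1), ∃ p, StepsTo R i a p ∧ StepsTo R (T - i) p b := by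
    intro i
    rw [← stepsTo_add, Nat.add_sub_cancel' (Nat.lt_succ_iff.1 i.isLt)]
    exact Nat.find_spec hex
  choose p hp hp' using hsplit
  -- If `p i = p j`, joining the first `i` steps to the last `T - j` gives a walk of length `i + (T
  -- - j)`, which minimality bounds below by `T`.
  have hle : ∀ i j, p i = p j → (j : ℕ) ≤ i := by
    intro i j hij
    have := hmin _ (stepsTo_add.2 ⟨p i, hp i, hij ▸ hp' j⟩)
    have := j.isLt
    omega
  have hinj : Function.Injective p := fun i j hij =>
    Fin.ext (le_antisymm (hle j i hij.symm) (hle i j hij))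
  have := Fintype.card_le_of_injective p hinj
  rw [Fintype.card_fin] at this
  exact ⟨T, this, Nat.find_spec hex⟩

/-! ### Counters in base `N` -/

/-- The value of a tuple of digits in base `N`. -/
def digitValue {N t : ℕ} (u : Fin t → Fin N) : ℕ := finFunctionFinEquiv u

theorem digitValue_lt {N t : ℕ} (u : Fin t → Fin N) : digitValue u < N ^ t :=
  (finFunctionFinEquiv u).isLt

theorem digitValue_inj {N t : ℕ} {u v : Fin t → Fin N} : digitValue u = digitValue v ↔ u = v :=
  Fin.ext_iff.symm.trans finFunctionFinEquiv.apply_eq_iff_eq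

theorem exists_digitValue {N t m : ℕ} (hm : m < N ^ t) :
    ∃ u : Fin t → Fin N, digitValue u = m :=
  ⟨finFunctionFinEquiv.symm ⟨m, hm⟩, by rw [digitValue, Equiv.apply_symm_apply]⟩

theorem digitValue_zero {N t : ℕ} {u : Fin t → Fin N} (h : ∀ i, (u i : ℕ) = 0) :
    digitValue u = 0 := by
  rw [digitValue, finFunctionFinEquiv_apply]
  simp [h]

theorem digitValue_succ {N t : ℕ} (u : Fin (t + 1) → Fin N) :
    digitValue u = digitValue (fun i => u i.succ) * N + u 0 := by
  simp only [digitValue, finFunctionFinEquiv_apply]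
  rw [Fin.sum_univ_succ, Finset.sum_mul, add_comm]
  simp [pow_succ, mul_assoc]

/-- This is addition with carry, least significant digit first: either the lowest digit increases
and the others agree, or it passes from `N - 1` to 0 and the carry goes to the remaining digits. The
counter does not wrap around, so its maximal value has no successor. -/
theorem FODefinable.digitValue_add_one {σ : FirstOrder.Language.{0, 0}} {X : Type*}
    {F : X → FinStr σ} {α : Type} {t : ℕ} (f g : Fin t → α) :
    FODefinable F fun x w => digitValue (fun i => w (f i)) + 1 = digitValue (fun i => w (g i)) := by
  induction t with
  | zero =>
    refine (FODefinable.const False).congr fun _ w => ?_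
    simp [digitValue]
  | succ t ih =>
    refine (((succ (f 0) (g 0)).and (finAll fun i : Fin t => eq (f i.succ) (g i.succ))).or
      (((last (f 0)).and (zero (g 0))).and
        (ih (fun i => f i.succ) (fun i => g i.succ)))).congr fun x w => ?_
    rw [digitValue_succ, digitValue_succ]
    have ha := (w (f 0)).isLt
    have hb := (w (g 0)).isLt
    have htail : (∀ i : Fin t, w (f i.succ) = w (g i.succ)) ↔
        digitValue (fun i => w (f i.succ)) = digitValue (fun i => w (g i.succ)) := by
      rw [digitValue_inj, funext_iff]
    rw [htail]
    generalize digitValue (fun i => w (f i.succ)) = s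
    generalize digitValue (fun i => w (g i.succ)) = s'
    rcases Nat.lt_or_ge ((w (f 0) : ℕ) + 1) (F x).card with h | h
    · rw [add_assoc, mul_add_inj h hb]
      constructor
      · rintro (⟨h1, h2⟩ | ⟨⟨h1, -⟩, -⟩)
        · exact ⟨h2, h1⟩
        · omega
      · rintro ⟨h1, h2⟩
        exact Or.inl ⟨h2, h1⟩
    · have he : (w (f 0) : ℕ) + 1 = (F x).card := by omega
      rw [add_assoc, he, show s * (F x).card + (F x).card = (s + 1) * (F x).card + 0 by ring,
        mul_add_inj (by omega) hb]
      constructor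
      · rintro (⟨h1, -⟩ | ⟨⟨-, h2⟩, h3⟩)
        · omega
        · exact ⟨h3, h2.symm⟩
      · rintro ⟨h1, h2⟩
        exact Or.inr ⟨⟨rfl, h2.symm⟩, h1⟩

/-! ### Encoding of configurations -/

/-- The one-hot code of `a`, where the base point `a₀` is coded by zeros. -/
def Hot {α : Type*} (a₀ a b : α) : Prop := a = b ∧ a ≠ a₀

theorem Hot.injective {α : Type*} {a₀ a a' : α} (h : ∀ b, Hot a₀ a b ↔ Hot a₀ a' b) : a = a' := by
  by_cases ha : a = a₀
  · by_contra hne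
    exact ((h a').2 ⟨rfl, fun e => hne (ha.trans e.symm)⟩).2 ha
  · exact ((h a).1 ⟨rfl, ha⟩).1.symm

instance : Finite InSym :=
  Finite.of_surjective (fun o : Option (Option Bool) => match o with
    | none => InSym.leftEnd
    | some none => InSym.rightEnd
    | some (some b) => InSym.bit b)
    (by rintro (_ | _ | b)
        exacts [⟨none, rfl⟩, ⟨some none, rfl⟩, ⟨some (some b), rfl⟩])

instance : Finite Move :=
  Finite.of_surjective (fun o : Option Bool => match o with
    | none => Move.stay
    | some true => Move.left
    | some false => Move.right)
    (by rintro (_ | _ | _)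
        exacts [⟨some true, rfl⟩, ⟨none, rfl⟩, ⟨some false, rfl⟩])

namespace Machine

variable (M : Machine) (K : ℕ)

/-- The variables describing a configuration.  The work tape cell `j * (K + 1) + c` is described by
the bits at position `j` of the variables `(c, γ)`, and the work head position
`j * (K + 1) + c` by the residue `c`, coded with the state, and the quotient `j`. -/
abbrev CfgVar : Type := (M.Q × Fin (K + 1)) ⊕ (Fin (K + 1) × M.Γ) ⊕ Bool

variable {M K}

namespace CfgVar

abbrev ctrl (y : M.Q × Fin (K + 1)) : M.CfgVar K := Sum.inl y
abbrev cell (c : Fin (K + 1)) (γ : M.Γ) : M.CfgVar K := Sum.inr (Sum.inl (c, γ))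
abbrev inPos : M.CfgVar K := Sum.inr (Sum.inr true)
abbrev offset : M.CfgVar K := Sum.inr (Sum.inr false)

end CfgVar

open CfgVar

-- State and residue are coded jointly by variables with values 0 and 1, and the initial pair is
-- coded by zeros.
open Classical in
def CtrlIs {N : ℕ} (u : M.CfgVar K → Fin N) (q : M.Q) (c : Fin (K + 1)) : Prop :=
  ∀ y, (u (ctrl y) : ℕ) = if Hot (M.start, 0) (q, c) y then 1 else 0

/-- The configuration described by `u` has state `q`, its work head is in a cell with residue `c`,
and the heads scan the symbols `s` and `γ`. -/
def Scans (x : List Bool) {N : ℕ} (u : M.CfgVar K → Fin N) (q : M.Q) (c : Fin (K + 1)) (s : InSym)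
    (γ : M.Γ) : Prop :=
  CtrlIs u q c ∧ readInput x (u inPos) = s ∧
    ∀ γ', (u (cell c γ') : ℕ).testBit (u offset) = true ↔ Hot M.blank γ γ'

/-- `v` describes the result of writing `γ` in the scanned cell, of residue `c`, of `u`. -/
def Writes {N : ℕ} (u v : M.CfgVar K → Fin N) (c : Fin (K + 1)) (γ : M.Γ) : Prop :=
  ∀ c' γ' (j : Fin N), (v (cell c' γ') : ℕ).testBit j = true ↔
    (c' = c ∧ j = u offset ∧ Hot M.blank γ γ') ∨
      (¬ (c' = c ∧ j = u offset) ∧ (u (cell c' γ') : ℕ).testBit j = true)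

/-- The quantified data range over finite sets depending only on the machine and `K`, so the
existential quantifiers amount to a finite disjunction. -/
def CfgStep (x : List Bool) {N : ℕ} (u v : M.CfgVar K → Fin N) : Prop :=
  ∃ q c s γ, Scans x u q c s γ ∧ ∃ q' γ' mi mw c', M.δ q s γ = some (q', γ', mi, mw) ∧
    CtrlIs v q' c' ∧ min (movePos mi (u inPos)) (x.length + 1) = v inPos ∧
    movePos mw (u offset * (K + 1) + c) = v offset * (K + 1) + c' ∧ Writes u v c γ'

def CfgAccepts (x : List Bool) {N : ℕ} (u : M.CfgVar K → Fin N) : Prop :=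
  ∃ q c s γ, Scans x u q c s γ ∧ M.δ q s γ = none ∧ q ∈ M.accepting

/-! ### Determinism of the coded step relation -/

section Functional

variable {x : List Bool} {N : ℕ} {u v w : M.CfgVar K → Fin N}

theorem CtrlIs.unique {q q' : M.Q} {c c' : Fin (K + 1)} (h : CtrlIs u q c) (h' : CtrlIs u q' c') :
    q = q' ∧ c = c' := by
  classical
  refine Prod.mk.inj (Hot.injective (a₀ := (M.start, (0 : Fin (K + 1)))) fun y => ?_)
  have := (h y).symm.trans (h' y)
  by_cases h1 : Hot (M.start, 0) (q, c) y <;> by_cases h2 : Hot (M.start, 0) (q', c') y <;>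
    simp_all

theorem Scans.unique {q q' : M.Q} {c c' : Fin (K + 1)} {s s' : InSym} {γ γ' : M.Γ}
    (h : Scans x u q c s γ) (h' : Scans x u q' c' s' γ') :
    q = q' ∧ c = c' ∧ s = s' ∧ γ = γ' := by
  obtain ⟨rfl, rfl⟩ := h.1.unique h'.1
  exact ⟨rfl, rfl, h.2.1.symm.trans h'.2.1,
    Hot.injective fun b => (h.2.2 b).symm.trans (h'.2.2 b)⟩

theorem Writes.unique {c : Fin (K + 1)} {γ : M.Γ} (h : Writes u v c γ) (h' : Writes u w c γ)
    (c' : Fin (K + 1)) (γ' : M.Γ) : v (cell c' γ') = w (cell c' γ') := by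
  refine Fin.ext (Nat.eq_of_testBit_eq fun j => ?_)
  rcases Nat.lt_or_ge j N with hj | hj
  · exact Bool.eq_iff_iff.2 ((h c' γ' ⟨j, hj⟩).trans (h' c' γ' ⟨j, hj⟩).symm)
  -- Elements are below `N < 2 ^ N`, so bits at positions outside the universe are zero and `Writes`
  -- fixes the whole number.
  · have hlt : ∀ a : Fin N, (a : ℕ) < 2 ^ j := fun a =>
      (a.isLt.trans_le hj).trans Nat.lt_two_pow_self
    rw [Nat.testBit_lt_two_pow (hlt _), Nat.testBit_lt_two_pow (hlt _)]

/-- Every variable of the successor is prescribed. No assumption that `u` encodes a configuration is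
made: the tree-width bound concerns the whole matrix, including meaningless tuples. -/
theorem CfgStep.unique (h : CfgStep x u v) (h' : CfgStep x u w) : v = w := by
  obtain ⟨q, c, s, γ, hs, p, g, mi, mw, e, hδ, hc, hi, ho, hw⟩ := h
  obtain ⟨q', c', s', γ', hs', p', g', mi', mw', e', hδ', hc', hi', ho', hw'⟩ := h'
  obtain ⟨rfl, rfl, rfl, rfl⟩ := hs.unique hs'
  rw [hδ] at hδ'
  simp only [Option.some.injEq, Prod.mk.injEq] at hδ'
  obtain ⟨rfl, rfl, rfl, rfl⟩ := hδ'
  rw [ho] at ho'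
  obtain ⟨ho1, ho2⟩ := (mul_add_inj e.isLt e'.isLt).1 ho'
  cases Fin.ext ho2
  funext y
  rcases y with y | ⟨c', γ'⟩ | _ | _
  · exact Fin.ext ((hc y).trans (hc' y).symm)
  · exact hw.unique hw' c' γ'
  · exact Fin.ext ho1
  · exact Fin.ext (hi.symm.trans hi')

theorem CfgAccepts.not_cfgStep (h : CfgAccepts x u) : ¬ CfgStep x u v := by
  rintro ⟨q, c, s, γ, hs, p, g, mi, mw, e, hδ, -⟩
  obtain ⟨q', c', s', γ', hs', hδ', -⟩ := h
  obtain ⟨rfl, rfl, rfl, rfl⟩ := hs.unique hs'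
  simp [hδ] at hδ'

end Functional

/-! ### Simulation -/

/-- `u` describes the configuration `c`, whose tape is blank from cell `L * (K + 1)` on. -/
structure Encodes (L : ℕ) (c : M.Cfg) {N : ℕ} (u : M.CfgVar K → Fin N) : Prop where
  ctrlIs : CtrlIs u c.state (Fin.ofNat (K + 1) c.head)
  inPos_eq : (u inPos : ℕ) = c.inPos
  offset_eq : (u offset : ℕ) = c.head / (K + 1)
  cell_lt : ∀ i γ, (u (cell i γ) : ℕ) < 2 ^ L
  testBit_cell : ∀ (i : Fin (K + 1)) γ j, (u (cell i γ) : ℕ).testBit j = true ↔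
    Hot M.blank (c.tape (j * (K + 1) + i)) γ

section Simulation

variable {x : List Bool} {N L : ℕ} {c c' : M.Cfg} {u v : M.CfgVar K → Fin N}

theorem Encodes.tape_eq_blank (h : Encodes L c u) {j : ℕ} (hj : L ≤ j) (i : Fin (K + 1)) :
    c.tape (j * (K + 1) + i) = M.blank := by
  by_contra hne
  have := (h.testBit_cell i _ j).2 ⟨rfl, hne⟩
  rw [Nat.testBit_lt_two_pow ((h.cell_lt i _).trans_le (Nat.pow_le_pow_right two_pos hj))] at this
  exact Bool.false_ne_true this

/-- For each residue and symbol, `L` bits describe the nonblank region, and they form a number below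
`2 ^ L ≤ N`; the quotient of the head position is below `L`, hence also below `N`. -/
theorem exists_encodes (hN : 2 ≤ N) (hL : 2 ^ L ≤ N) (hi : c.inPos < N)
    (hh : c.head < (K + 1) * L)
    (hb : ∀ j, L ≤ j → ∀ i : Fin (K + 1), c.tape (j * (K + 1) + i) = M.blank) :
    ∃ u : M.CfgVar K → Fin N, Encodes L c u := by
  classical
  have hoff : c.head / (K + 1) < N :=
    (Nat.div_lt_of_lt_mul hh).trans (Nat.lt_two_pow_self.trans_le hL)
  let bits : Fin (K + 1) → M.Γ → Fin L → Bool := fun i γ j =>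
    decide (Hot M.blank (c.tape (j * (K + 1) + i)) γ)
  refine ⟨Sum.elim (fun y => if Hot (M.start, 0) (c.state, Fin.ofNat (K + 1) c.head) y
      then ⟨1, by omega⟩ else ⟨0, by omega⟩)
    (Sum.elim (fun y => ⟨Nat.ofBits (bits y.1 y.2), (Nat.ofBits_lt_two_pow _).trans_le hL⟩)
      fun b => if b = true then ⟨c.inPos, hi⟩ else ⟨c.head / (K + 1), hoff⟩), ?_, ?_, ?_, ?_, ?_⟩
  · intro y
    simp only [Sum.elim_inl]
    split_ifs <;> rfl
  · simp
  · simp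
  · intro i γ
    exact Nat.ofBits_lt_two_pow _
  · intro i γ j
    simp only [Sum.elim_inr, Sum.elim_inl]
    rcases Nat.lt_or_ge j L with hj | hj
    · rw [Nat.testBit_ofBits_lt _ _ hj]
      simp [bits]
    · rw [Nat.testBit_ofBits_ge _ _ hj, hb j hj i]
      simp [Hot]

theorem Encodes.scans (h : Encodes L c u) :
    Scans x u c.state (Fin.ofNat (K + 1) c.head) (readInput x c.inPos) (c.tape c.head) := by
  refine ⟨h.ctrlIs, by rw [h.inPos_eq], fun γ' => ?_⟩
  rw [h.testBit_cell, h.offset_eq, Fin.val_ofNat, Nat.div_add_mod']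

theorem Encodes.cfgStep (h : Encodes L c u) (h' : Encodes L c' v)
    (hstep : M.step x c = some c') : CfgStep x u v := by
  refine ⟨_, _, _, _, h.scans, ?_⟩
  rw [step] at hstep
  split at hstep
  · cases hstep
  · rename_i q a mi mw hδ
    obtain rfl := Option.some.inj hstep
    refine ⟨q, a, mi, mw, _, hδ, h'.ctrlIs, ?_, ?_, ?_⟩
    · rw [h.inPos_eq, h'.inPos_eq]
    · rw [h.offset_eq, h'.offset_eq, Fin.val_ofNat, Fin.val_ofNat, Nat.div_add_mod',
        Nat.div_add_mod']
    · intro i γ j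
      rw [h'.testBit_cell, h.testBit_cell]
      have hiff : (j : ℕ) * (K + 1) + i = c.head ↔
          i = Fin.ofNat (K + 1) c.head ∧ j = u offset := by
        rw [← Nat.div_add_mod' c.head (K + 1),
          mul_add_inj i.isLt (Nat.mod_lt _ (Nat.succ_pos _)), and_comm, Fin.ext_iff, Fin.ext_iff,
          h.offset_eq, Fin.val_ofNat, Nat.div_add_mod']
      by_cases hj : (j : ℕ) * (K + 1) + i = c.head
      · have := hiff.1 hj
        change Hot M.blank (Function.update c.tape c.head a _) γ ↔ _
        rw [hj, Function.update_self]
        tauto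
      · have := fun e => hj (hiff.2 e)
        change Hot M.blank (Function.update c.tape c.head a _) γ ↔ _
        rw [Function.update_of_ne hj]
        tauto

theorem Encodes.exists_cfgStep (hN : N = x.length + 2) (hL : 2 ^ L ≤ N) (h : Encodes L c u)
    (hstep : M.step x c = some c') (hh : c.head < (K + 1) * L) (hh' : c'.head < (K + 1) * L) :
    ∃ v : M.CfgVar K → Fin N, Encodes L c' v ∧ CfgStep x u v := by
  obtain ⟨v, hv⟩ : ∃ v : M.CfgVar K → Fin N, Encodes L c' v := by
    have hs := hstep
    rw [step] at hs
    split at hs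
    · cases hs
    · obtain rfl := Option.some.inj hs
      refine exists_encodes (by omega) hL ?_ hh' fun j hj i => ?_
      · exact (Nat.min_le_right _ _).trans_lt (by omega)
      -- Only the scanned cell changes, and it lies below `(K + 1) * L`, so the tape stays blank
      -- beyond this bound.
      · have : j * (K + 1) + i ≠ c.head := by
          have := Nat.mul_le_mul_left (K + 1) hj
          rw [mul_comm j]
          omega
        exact (Function.update_of_ne this _ _).trans (h.tape_eq_blank hj i)
  exact ⟨v, hv, h.cfgStep hv hstep⟩

/-- Start state with residue 0, and the blank symbol, have zero codes. The start vertex is therefore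
the all-zero tuple, which is easy to define. -/
theorem encodes_init {u : M.CfgVar K → Fin N} (hu : ∀ y, (u y : ℕ) = 0) : Encodes L M.init u := by
  classical
  refine ⟨fun y => ?_, hu _, ?_, fun i γ => ?_, fun i γ j => ?_⟩
  · rw [hu, if_neg]
    rintro ⟨-, h⟩
    exact h (Prod.ext rfl (Fin.ext (by simp [init])))
  · rw [hu]; simp [init]
  · rw [hu]; positivity
  · rw [hu]; simp [init, Hot]

theorem Encodes.reachable (hN : N = x.length + 2) (hL : 2 ^ L ≤ N)
    (hh : ∀ c, M.Reaches x c → c.head < (K + 1) * L) (hu : Encodes L M.init u)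
    (hc : M.Reaches x c) :
    ∃ v : M.CfgVar K → Fin N, Encodes L c v ∧ Relation.ReflTransGen (CfgStep x) u v := by
  induction hc with
  | refl => exact ⟨u, hu, .refl⟩
  | @tail c c' hc hstep ih =>
    obtain ⟨v, hv, huv⟩ := ih
    obtain ⟨w, hw, hvw⟩ := hv.exists_cfgStep hN hL hstep (hh c hc) (hh c' (hc.tail hstep))
    exact ⟨w, hw, huv.tail hvw⟩

theorem step_eq_none_iff : M.step x c = none ↔
    M.δ c.state (readInput x c.inPos) (c.tape c.head) = none := by
  rw [step]
  split <;> simp_all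

theorem Encodes.not_cfgStep (h : Encodes L c u) (hstep : M.step x c = none) :
    ¬ CfgStep x u v := by
  rintro ⟨q, i, s, γ, hs, p, g, mi, mw, e, hδ, -⟩
  obtain ⟨rfl, rfl, rfl, rfl⟩ := hs.unique h.scans
  rw [step_eq_none_iff.1 hstep] at hδ
  cases hδ

theorem Encodes.cfgAccepts_iff (h : Encodes L c u) (hstep : M.step x c = none) :
    CfgAccepts x u ↔ c.state ∈ M.accepting := by
  constructor
  · rintro ⟨q, i, s, γ, hs, -, hq⟩
    rwa [(hs.unique h.scans).1] at hq
  · intro hq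
    exact ⟨_, _, _, _, h.scans, step_eq_none_iff.1 hstep, hq⟩

end Simulation
end Machine

/-! ### Definability of the step relation -/

/-- Each case is first-order over a word structure: the markers are the first and last elements,
ones are given by the predicate, and zeros are what remains. -/
theorem readInput_eq_iff {x : List Bool} {n : ℕ} (hn : n < x.length + 2) (s : InSym) :
    Machine.readInput x n = s ↔ match s with
      | InSym.leftEnd => n = 0
      | InSym.rightEnd => n + 1 = x.length + 2
      | InSym.bit true => 1 ≤ n ∧ x[n - 1]? = some true
      | InSym.bit false => (n ≠ 0 ∧ n + 1 ≠ x.length + 2) ∧ ¬ (1 ≤ n ∧ x[n - 1]? = some true) := by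
  rcases n with _ | n
  · rcases s with _ | _ | _ | _ <;> simp [Machine.readInput]
  · rcases Nat.lt_or_ge n x.length with hn | hn
    · rcases hx : x[n] <;> rcases s with _ | _ | _ | _ <;>
        simp [Machine.readInput, hn, hx, hn.ne]
    · obtain rfl : n = x.length := by omega
      rcases s with _ | _ | _ | _ <;> simp [Machine.readInput]

/-- The conditions on `c`, `d` and `P` are constants of the reduction, and those on `a` and `b` need
only equality, successor and zero. The third case for `left` is the head staying in cell 0. -/
theorem movePos_iff {P a b c d : ℕ} (hc : c < P) (hd : d < P) (m : Move) :
    Machine.movePos m (a * P + c) = b * P + d ↔ match m with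
      | Move.stay => c = d ∧ a = b
      | Move.right => (c + 1 = d ∧ a = b) ∨ ((c + 1 = P ∧ d = 0) ∧ a + 1 = b)
      | Move.left => (d + 1 = c ∧ a = b) ∨ ((c = 0 ∧ d + 1 = P) ∧ b + 1 = a) ∨
          ((c = 0 ∧ d = 0) ∧ a = 0 ∧ b = 0) := by
  cases m with
  | stay =>
    simp only [Machine.movePos]
    rw [mul_add_inj hc hd, and_comm]
  | right =>
    simp only [Machine.movePos]
    rcases Nat.lt_or_ge (c + 1) P with h | h
    · rw [add_assoc, mul_add_inj h hd]
      omega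
    · obtain rfl : P = c + 1 := by omega
      rw [add_assoc, show a * (c + 1) + (c + 1) = (a + 1) * (c + 1) + 0 by ring,
        mul_add_inj (by omega) hd]
      omega
  | left =>
    simp only [Machine.movePos]
    rcases c with _ | c
    · rcases a with _ | a
      · rw [show 0 * P + 0 - 1 = 0 * P + 0 by simp, mul_add_inj hc hd]
        omega
      · rw [show (a + 1) * P + 0 - 1 = a * P + (P - 1) by rw [add_mul]; omega,
          mul_add_inj (by omega) hd]
        omega
    · rw [← add_assoc, Nat.add_sub_cancel, mul_add_inj (by omega) hd]
      omega

namespace Machine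

open FODefinable CfgVar

variable {M : Machine} {K : ℕ} {α : Type}

instance : Finite M.Q := M.finQ

instance : Finite M.Γ := M.finΓ

theorem ctrlIs_definable (f : M.CfgVar K → α) (q : M.Q) (c : Fin (K + 1)) :
    FODefinable wordStr fun _ w => CtrlIs (fun y => w (f y)) q c := by
  classical
  refine finAll fun y => ?_
  by_cases h : Hot (M.start, 0) (q, c) y
  · simpa only [if_pos h] using one (f (ctrl y))
  · simpa only [if_neg h] using zero (f (ctrl y))

theorem readInput_definable (a : α) (s : InSym) :
    FODefinable wordStr fun x w => readInput x (w a) = s := by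
  have hrel : FODefinable wordStr fun x w => (wordStr x).Rel WordRel.one ![w a] :=
    (rel WordRel.one ![a]).congr fun x w => by
      rw [show (fun i => w ((![a] : Fin 1 → _) i)) = ![w a] by ext i; fin_cases i; rfl]
  have h := fun x (w : α → Fin (wordStr x).card) => (readInput_eq_iff (w a).isLt s).symm
  rcases s with _ | _ | _ | _
  · exact (zero a).congr h
  · exact (last a).congr h
  · exact (((zero a).not.and (last a).not).and hrel.not).congr h
  · exact hrel.congr h

theorem scans_definable (f : M.CfgVar K → α) (q : M.Q) (c : Fin (K + 1)) (s : InSym) (γ : M.Γ) :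
    FODefinable wordStr fun x w => Scans x (fun y => w (f y)) q c s γ :=
  (ctrlIs_definable f q c).and ((readInput_definable (f inPos) s).and
    (finAll fun γ' => (testBit (f (cell c γ')) (f offset)).iff (const _)))

theorem writes_definable (f g : M.CfgVar K → α) (c : Fin (K + 1)) (γ : M.Γ) :
    FODefinable wordStr fun _ w => Writes (fun y => w (f y)) (fun y => w (g y)) c γ := by
  refine finAll fun c' => finAll fun γ' => all ?_
  refine (testBit (Sum.inl (g (cell c' γ'))) (Sum.inr ())).iff (FODefinable.or ?_ ?_)
  · exact (const _).and ((eq (Sum.inr ()) (Sum.inl (f offset))).and (const _))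
  · exact ((const _).and (eq (Sum.inr ()) (Sum.inl (f offset)))).not.and
      (testBit (Sum.inl (f (cell c' γ'))) (Sum.inr ()))

theorem moveInput_definable (m : Move) (a b : α) :
    FODefinable wordStr fun x w => min (movePos m (w a)) (x.length + 1) = w b := by
  have hlt : ∀ x (w : α → Fin (wordStr x).card) a, (w a : ℕ) < x.length + 2 :=
    fun x w a => (w a).isLt
  have hcard : ∀ x, (wordStr x).card = x.length + 2 := fun _ => rfl
  cases m with
  | stay =>
    refine (eq a b).congr fun x w => ?_
    have := hlt x w a
    simp only [movePos, Fin.ext_iff]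
    omega
  | left =>
    refine (((zero a).and (zero b)).or (succ b a)).congr fun x w => ?_
    have := hlt x w a
    simp only [movePos]
    omega
  | right =>
    refine ((succ a b).or ((last a).and (eq a b))).congr fun x w => ?_
    have := hlt x w a
    have := hlt x w b
    simp only [movePos, Fin.ext_iff, hcard]
    omega

theorem moveHead_definable (m : Move) (a b : α) (c d : Fin (K + 1)) :
    FODefinable wordStr fun _ w =>
      movePos m (w a * (K + 1) + c) = w b * (K + 1) + d := by
  refine FODefinable.congr ?_ fun x w => (movePos_iff c.isLt d.isLt m).symm
  cases m with
  | stay => exact (const _).and ((eq a b).congr fun x w => Fin.ext_iff)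
  | right =>
    exact ((const _).and ((eq a b).congr fun x w => Fin.ext_iff)).or ((const _).and (succ a b))
  | left =>
    exact ((const _).and ((eq a b).congr fun x w => Fin.ext_iff)).or
      (((const _).and (succ b a)).or ((const _).and ((zero a).and (zero b))))

theorem cfgStep_definable (f g : M.CfgVar K → α) :
    FODefinable wordStr fun x w => CfgStep x (fun y => w (f y)) (fun y => w (g y)) :=
  finEx fun q => finEx fun c => finEx fun s => finEx fun γ => (scans_definable f q c s γ).and <|
    finEx fun q' => finEx fun γ' => finEx fun mi => finEx fun mw => finEx fun c' =>
      (const _).and <| (ctrlIs_definable g q' c').and <|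
        (moveInput_definable mi (f inPos) (g inPos)).and <|
          (moveHead_definable mw (f offset) (g offset) c c').and (writes_definable f g c γ')

theorem cfgAccepts_definable (f : M.CfgVar K → α) :
    FODefinable wordStr fun x w => CfgAccepts x (fun y => w (f y)) :=
  finEx fun q => finEx fun c => finEx fun s => finEx fun γ => (scans_definable f q c s γ).and <|
    (const _).and (const _)

/-! ### The timed configuration graph -/

/-- Steps of the machine that increment a counter; accepting halting configurations have loops. -/
def TimedStep {t : ℕ} (x : List Bool) {N : ℕ} (u v : M.CfgVar K ⊕ Fin t → Fin N) : Prop :=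
  (CfgStep x (fun y => u (Sum.inl y)) (fun y => v (Sum.inl y)) ∧
    digitValue (fun i => u (Sum.inr i)) + 1 = digitValue (fun i => v (Sum.inr i))) ∨
  (u = v ∧ CfgAccepts x (fun y => u (Sum.inl y)))

section Timed

variable {t N : ℕ} {x : List Bool} {u v w : M.CfgVar K ⊕ Fin t → Fin N}

theorem timedStep_definable : FODefinable wordStr
    (α := (M.CfgVar K ⊕ Fin t) ⊕ (M.CfgVar K ⊕ Fin t))
    fun x w => TimedStep x (w ∘ Sum.inl) (w ∘ Sum.inr) :=
  ((cfgStep_definable _ _).and (digitValue_add_one _ _)).or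
    (((finAll fun y => eq (Sum.inl y) (Sum.inr y)).congr fun _ _ => funext_iff.symm).and
      (cfgAccepts_definable _))

theorem TimedStep.rank (h : TimedStep x u v) :
    u = v ∨ digitValue (fun i => u (Sum.inr i)) < digitValue (fun i => v (Sum.inr i)) := by
  rcases h with ⟨-, h⟩ | ⟨h, -⟩
  · right; omega
  · exact Or.inl h

/-- Configuration and clock are both determined by a machine step, and an accepting halting
configuration has no machine step competing with its loop. -/
theorem TimedStep.unique (h : TimedStep x u v) (h' : TimedStep x u w) : v = w := by
  rcases h with ⟨h, ht⟩ | ⟨rfl, h⟩ <;> rcases h' with ⟨h', ht'⟩ | ⟨rfl, h'⟩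
  · have h1 := h.unique h'
    have h2 := digitValue_inj.1 (ht.symm.trans ht')
    funext y
    rcases y with y | y
    · exact congrFun h1 y
    · exact congrFun h2 y
  · exact absurd h h'.not_cfgStep
  · exact absurd h' h.not_cfgStep
  · rfl

theorem timedStep_self : TimedStep x v v ↔ CfgAccepts x (fun y => v (Sum.inl y)) := by
  simp [TimedStep]

theorem cfgStep_reachable_of_timed (h : Relation.ReflTransGen (TimedStep x) u v) :
    Relation.ReflTransGen (CfgStep x) (fun y => u (Sum.inl y)) (fun y => v (Sum.inl y)) := by
  induction h with
  | refl => rfl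
  | tail _ h ih =>
    rcases h with ⟨h, -⟩ | ⟨rfl, -⟩
    · exact ih.tail h
    · exact ih

/-- A machine walk lifts to the timed graph as long as the clock cannot overflow. -/
theorem exists_timed_reachable {m : ℕ} {a b : M.CfgVar K → Fin N} (h : StepsTo (CfgStep x) m a b)
    (s : Fin t → Fin N) (hs : digitValue s + m < N ^ t) :
    ∃ s' : Fin t → Fin N,
      Relation.ReflTransGen (TimedStep x) (Sum.elim a s) (Sum.elim b s') := by
  induction m generalizing a s with
  | zero => cases h; exact ⟨s, .refl⟩
  | succ m ih =>
    obtain ⟨c, hc, h⟩ := h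
    obtain ⟨s₁, hs₁⟩ := exists_digitValue (N := N) (t := t) (m := digitValue s + 1) (by omega)
    obtain ⟨s', hs'⟩ := ih h s₁ (by omega)
    exact ⟨s', .head (b := Sum.elim c s₁) (Or.inl ⟨hc, hs₁.symm⟩) hs'⟩

end Timed

end Machine

/-! ### Hardness for logarithmic space -/

theorem wordStr_injective : Function.Injective wordStr := by
  classical
  let decode : FinStr wordLang → List Bool := fun S =>
    (List.range (S.card - 2)).map fun i =>
      decide (∃ h : i + 1 < S.card, S.Rel WordRel.one ![⟨i + 1, h⟩])
  refine Function.LeftInverse.injective (g := decode) fun x => ?_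
  have hcard : (wordStr x).card = x.length + 2 := rfl
  refine List.ext_getElem (by simp [decode, hcard]) fun i h h' => ?_
  have hone : ∀ hi : i + 1 < (wordStr x).card,
      (wordStr x).Rel WordRel.one ![⟨i + 1, hi⟩] ↔ 1 ≤ i + 1 ∧ x[i + 1 - 1]? = some true :=
    fun _ => Iff.rfl
  simp only [decode, List.getElem_map, List.getElem_range, hone, hcard]
  cases hx : x[i] <;> simp [h', hx, h'.le]

/-- This puts the space bound in the form `(K + 1) * L` with `K = 2 * C`; the additive `C` is
absorbed because the logarithm of `n + 2` is at least 1. -/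
theorem log_add_one_le (C n : ℕ) :
    C * (Nat.log 2 n + 1) ≤ (2 * C + 1) * Nat.log 2 (n + 2) := by
  have h1 : Nat.log 2 n ≤ Nat.log 2 (n + 2) := Nat.log_mono_right (by omega)
  have h2 : 1 ≤ Nat.log 2 (n + 2) := Nat.log_pos one_lt_two (by omega)
  nlinarith

theorem wordProblem_reducible {k : ℕ} (hk : 1 ≤ k) {A : Language Bool} (hA : A ∈ LogSpace) :
    FODisjunctiveReducible (wordProblem A) (matrixPowering k) := by
  obtain ⟨M, ⟨C, hC⟩, hM⟩ := hA
  have : Fintype (M.CfgVar (2 * C)) := Fintype.ofFinite _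
  -- With this many digits the clock has as many values as there are configuration tuples, enough
  -- for a shortest path.
  let t := Fintype.card (M.CfgVar (2 * C))
  let ι := M.CfgVar (2 * C) ⊕ Fin t
  let e : Fin (Fintype.card ι) ≃ ι := (Fintype.equivFin ι).symm
  have hcard : ∀ x, (wordStr x).card = x.length + 2 := fun _ => rfl
  -- The parameters spell out a whole vertex, clock included, so the disjunction ranges over all
  -- candidates for the final vertex.
  refine reducible_of_definable_forest (F := wordStr) (ι := ι) (d := Fintype.card ι) hk
    subset_rfl (fun x => by rw [hcard]; omega) (fun x u v => Machine.TimedStep x u v)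
    (fun x u => ∀ y, (u y : ℕ) = 0) (fun x z v => ∀ y, v y = z (e.symm y))
    (fun x u => digitValue fun i => u (Sum.inr i))
    Machine.timedStep_definable (FODefinable.finAll fun y => FODefinable.zero y)
    (FODefinable.finAll fun y => FODefinable.eq (Sum.inr y) (Sum.inl (e.symm y)))
    (fun x => ⟨fun _ => ⟨0, by rw [hcard]; omega⟩, fun _ => rfl, fun u hu => funext fun y =>
      Fin.ext (hu y)⟩)
    (fun x z => ⟨fun y => z (e.symm y), fun _ => rfl, fun u hu => funext hu⟩)
    (fun x u v w => Machine.TimedStep.unique) (fun x u v => Machine.TimedStep.rank) ?_ ?_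
  · intro x u
    refine (digitValue_lt _).trans_le (Nat.pow_le_pow_right (by rw [hcard]; omega) ?_)
    simp [ι]
  · intro x
    obtain ⟨c, hc, hhalt, hacc⟩ := hM x
    have hyes : wordStr x ∈ (wordProblem A).yes ↔ x ∈ A :=
      ⟨fun ⟨y, hy, h⟩ => wordStr_injective h ▸ hy, fun h => ⟨x, h, rfl⟩⟩
    have hinit : ∀ {u : M.CfgVar (2 * C) → Fin (wordStr x).card}, (∀ y, (u y : ℕ) = 0) →
        ∃ v : M.CfgVar (2 * C) → Fin (wordStr x).card,
          Machine.Encodes (Nat.log 2 (x.length + 2)) c v ∧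
            Relation.ReflTransGen (Machine.CfgStep x) u v := fun hu =>
      (Machine.encodes_init hu).reachable rfl (Nat.pow_log_le_self 2 (by omega))
        (fun c hc => (hC x c hc).trans_le (log_add_one_le C x.length)) hc
    rw [hyes, ← hacc]
    constructor
    · intro h
      let u₀ : M.CfgVar (2 * C) → Fin (wordStr x).card := fun _ => ⟨0, by rw [hcard]; omega⟩
      let s₀ : Fin t → Fin (wordStr x).card := fun _ => ⟨0, by rw [hcard]; omega⟩
      obtain ⟨v, hv, huv⟩ := hinit (u := u₀) fun _ => rfl
      classical
      obtain ⟨m, hm, hsteps⟩ := exists_stepsTo_lt_card huv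
      obtain ⟨s, hs⟩ := Machine.exists_timed_reachable hsteps s₀ (by
        rw [digitValue_zero fun _ => rfl, zero_add]
        simpa [t] using hm)
      refine ⟨fun i => Sum.elim v s (e i), _, _, ?_, fun y => ?_, hs, ?_⟩
      · rintro (y | y) <;> rfl
      · exact (congrArg (Sum.elim v s) (e.apply_symm_apply y)).symm
      · exact Machine.timedStep_self.2 ((hv.cfgAccepts_iff hhalt).2 h)
    · rintro ⟨z, u, v, hu, -, huv, hvv⟩
      have hv := Machine.timedStep_self.1 hvv
      obtain ⟨w, hw, huw⟩ := hinit (u := fun y => u (Sum.inl y)) fun y => hu _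
      -- Both tuples are reached from the initial one under a deterministic relation and neither has
      -- a successor, so they coincide.
      have hvw : (fun y => v (Sum.inl y)) = w := by
        have huniq : Relator.RightUnique
            (Machine.CfgStep (M := M) (K := 2 * C) (N := (wordStr x).card) x) :=
          fun _ _ _ h h' => h.unique h'
        rcases Relation.ReflTransGen.total_of_right_unique huniq
          (Machine.cfgStep_reachable_of_timed huv) huw with h | h
        · rcases h.cases_head with h | ⟨_, h, -⟩
          · exact h
          · exact absurd h hv.not_cfgStep
        · rcases h.cases_head with h | ⟨_, h, -⟩
          · exact h.symm
          · exact absurd h (hw.not_cfgStep hhalt)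
      exact (hw.cfgAccepts_iff hhalt).1 (hvw ▸ hv)

end BTPow
end

open BTPow
theorem mainTheorem11 :
    (∀ k : ℕ, 1 ≤ k → LHard (matrixPowering k)) ∧
    (∀ k : ℕ, 1 ≤ k → FODisjunctiveReducible ORD (matrixPowering k)) ∧
    (∀ (V : Type*) [Fintype V] [DecidableEq V] (E : V → V → Prop), IsDirectedPath E →
      ∀ s t : V, Relation.ReflTransGen E s t ↔
        ((1 + adjacency E) ^ Fintype.card V) s t ≠ 0) :=
  ⟨fun _ hk _ hA => wordProblem_reducible hk hA, fun _ hk => ord_reducible hk,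
    fun _ _ _ _ hE => hE.reachable_iff_pow_ne_zero⟩
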